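/- For a simple undirected graph $G$ on the vertex set $\{1,\dots,n\}$ with $m$ edges let $\mathrm{OPT}(G)$ be its MAX-CUT value, the largest number of edges with endpoints on opposite sides of a bipartition of the vertices. A \emph{stream} of $G$ is a sequence of edge insertions and deletions, in arbitrary order, in which only absent edges are inserted and only present edges are deleted, and after which exactly the edges of $G$ are present; it is \emph{insertion-only} if it has no deletions, and \emph{fully dynamic} in general. For $\epsilon\in(0,\frac12]$ and an optimal solution $x^*\in\{-1,1\}^n$ of MAX-CUT on $G$, \emph{$\epsilon$-accurate predictions} of $x^*$ are independent random labels $Y_1,\dots,Y_n\in\{-1,1\}$ with $\Pr[Y_v=x^*_v]=\frac12+\epsilon$ and $\Pr[Y_v=-x^*_v]=\frac12-\epsilon$ for every $v$. A single-pass streaming algorithm reads the stream once, each element $(u,v)$ annotated with the predictions $Y_u$ and $Y_v$, and outputs a real number at the end. It knows $n$, and it knows $\epsilon$ up to a constant factor $K\ge1$, that is, it is given a number $\epsilon_0$ with $\epsilon_0\le\epsilon\le K\epsilon_0$ (with $K=1$, it knows $\epsilon$). Its space is the number of words of $\lfloor\log_2 n\rfloor+1$ bits (one bit if $n=0$) of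 its memory, which holds all that it carries from one stream element to the next, including stored random bits; the predictor is not charged. \textbf{Theorem.} For every $K\ge 1$ there are constants $c>0$, $C$ and $d\in\mathbb N$ such that for all $n$ and $\epsilon_0$ there exist (a) a randomized single-pass streaming algorithm for insertion-only streams of graphs on $n$ vertices that uses at most $C\,(1/\epsilon)^{d}$ words of space, and (b) a randomized single-pass streaming algorithm for fully dynamic streams of graphs on $n$ vertices that uses at most $C\,(1/\epsilon)^{d}(1+\log n)^{d}$ words of space (with $\log n$ read as $0$ if $n=0$), with the following property, for every $\epsilon\in(0,\frac12]$ with $\epsilon_0\le\epsilon\le K\epsilon_0$: for every graph $G$ on $n$ vertices, every optimal solution $x^*$ of MAX-CUT on $G$, every stream of $G$ of the respective type, and $\epsilon$-accurate predictions of $x^*$, the output $X$ satisfies $$\Big(\tfrac12+c\,\epsilon^2\Big)\,\mathrm{OPT}(G)\;\le\; X\;\le\;\mathrm{OPT}(G)$$ with probability at least $2/3$ over the predictions and the random choices of the algorithm. -/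

import Mathlib

open MeasureTheory ProbabilityTheory

/-! ### Cuts -/

/-- The value `e(S, T)` of the cut `S = {v | x v = 1}`, `T = {v | x v = -1}` of `G`: the number of
edges with one endpoint in `S` and the other one in `T`, each listed once, from `S` to `T`. -/
noncomputable def cutValue {n : ℕ} (G : SimpleGraph (Fin n)) (x : Fin n → ℤˣ) : ℕ :=
  open Classical in
  (Finset.univ.filter fun p : Fin n × Fin n => G.Adj p.1 p.2 ∧ x p.1 = 1 ∧ x p.2 = -1).card

/-- The MAX-CUT value of `G`. -/
noncomputable def maxCut {n : ℕ} (G : SimpleGraph (Fin n)) : ℕ :=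
  Finset.univ.sup fun x : Fin n → ℤˣ => cutValue G x

/-- `x` is an optimal solution of MAX-CUT on `G`. -/
def IsOptimalCut {n : ℕ} (G : SimpleGraph (Fin n)) (x : Fin n → ℤˣ) : Prop :=
  cutValue G x = maxCut G

/-! ### Graph streams -/

/-- A stream element `((u, v), Δ)`: the edge `uv` is inserted if `Δ = 1` and deleted if `Δ = -1`. -/
structure EdgeUpdate (n : ℕ) where
  u : Fin n
  v : Fin n
  Δ : ℤˣ

/-- The multiplicity of the edge `e` after the updates `σ`: insertions minus deletions. -/
def edgeMultiplicity {n : ℕ} (σ : List (EdgeUpdate n)) (e : Sym2 (Fin n)) : ℤ :=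
  ((σ.filter fun a => s(a.u, a.v) = e).map fun a => (a.Δ : ℤ)).sum

/-- `σ` is a stream of edge insertions and deletions for the simple graph `G`: at every time an edge
is either absent or present once (only absent edges are inserted and only present ones are
deleted), and the edges that are present at the end are those of `G`. -/
structure IsGraphStream {n : ℕ} (σ : List (EdgeUpdate n)) (G : SimpleGraph (Fin n)) : Prop where
  ne : ∀ a ∈ σ, a.u ≠ a.v
  simple : ∀ τ, τ <+: σ → ∀ e, edgeMultiplicity τ e = 0 ∨ edgeMultiplicity τ e = 1
  final : ∀ e, e ∈ G.edgeSet ↔ edgeMultiplicity σ e = 1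

/-- The stream contains only edge insertions. -/
def IsInsertionOnly {n : ℕ} (σ : List (EdgeUpdate n)) : Prop :=
  ∀ a ∈ σ, a.Δ = 1

/-! ### Predictions -/

/-- `P` is the law of a random vector `Y` of `ε`-accurate predictions of `x`: the labels `Y v` are
independent, and each of them is `x v` with probability `1/2 + ε` and `-x v` otherwise. -/
structure IsAccuratePrediction {n : ℕ} (ε : ℝ) (x : Fin n → ℤˣ) (P : Measure (Fin n → ℤˣ)) :
    Prop where
  isProbabilityMeasure : IsProbabilityMeasure P
  indep : iIndepFun (fun (v : Fin n) (Y : Fin n → ℤˣ) => Y v) P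
  correct : ∀ v, P {Y | Y v = x v} = ENNReal.ofReal (1 / 2 + ε)
  incorrect : ∀ v, P {Y | Y v = -x v} = ENNReal.ofReal (1 / 2 - ε)

/-- A stream element together with the predicted labels of the two endpoints of its edge. -/
structure AnnotatedUpdate (n : ℕ) extends EdgeUpdate n where
  Yu : ℤˣ
  Yv : ℤˣ

/-- The stream `σ`, annotated with the predictions `Y`. -/
def annotate {n : ℕ} (Y : Fin n → ℤˣ) (σ : List (EdgeUpdate n)) : List (AnnotatedUpdate n) :=
  σ.map fun a => ⟨a, Y a.u, Y a.v⟩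

/-! ### Streaming algorithms -/

/-- The number of bits of a word for graphs on `n` vertices: the length of `n` in binary. -/
def wordBits (n : ℕ) : ℕ := Nat.log 2 n + 1

/-- The content of a memory of `S` words. -/
abbrev Memory (n S : ℕ) : Type := Fin S → Fin (2 ^ wordBits n)

/-- A randomized single-pass streaming algorithm for graphs on `n` vertices that uses `S` words of
space. Everything that it carries from one stream element to the next, including random bits that
are used again later, is in its memory; the random choices of a step are fresh given the memory. -/
structure StreamingAlgorithm (n S : ℕ) where
  init : PMF (Memory n S)
  update : AnnotatedUpdate n → Memory n S → PMF (Memory n S)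
  output : Memory n S → ℝ

namespace StreamingAlgorithm

variable {n S : ℕ}

/-- The distribution of the memory after one pass over a stream. -/
noncomputable def run (A : StreamingAlgorithm n S) (σ : List (AnnotatedUpdate n)) :
    PMF (Memory n S) :=
  σ.foldl (fun μ a => μ.bind (A.update a)) A.init

/-- The distribution of the output after one pass over a stream. -/
noncomputable def result (A : StreamingAlgorithm n S) (σ : List (AnnotatedUpdate n)) : PMF ℝ :=
  (A.run σ).map A.output

/-- The probability, over predictions with law `P` and the random choices of `A`, that the output
of `A` on the stream `σ` is an `α`-approximation of `opt`, that is, lies between `α * opt` and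
`opt`. -/
noncomputable def approxProb (A : StreamingAlgorithm n S) (α opt : ℝ)
    (P : Measure (Fin n → ℤˣ)) (σ : List (EdgeUpdate n)) : ENNReal :=
  ∫⁻ Y, (A.result (annotate Y σ)).toOuterMeasure (Set.Icc (α * opt) opt) ∂P

/-- For every graph on `n` vertices, every optimal cut `x` of it and every stream of the graph that
belongs to `streams`, the algorithm outputs an `α`-approximation of the MAX-CUT value with
probability at least `2/3` if it is given `ε`-accurate predictions of `x`. -/
def ApproximatesMaxCut (A : StreamingAlgorithm n S) (streams : Set (List (EdgeUpdate n)))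
    (ε α : ℝ) : Prop :=
  ∀ (G : SimpleGraph (Fin n)) (x : Fin n → ℤˣ) (σ : List (EdgeUpdate n))
    (P : Measure (Fin n → ℤˣ)),
    IsOptimalCut G x → σ ∈ streams → IsGraphStream σ G → IsAccuratePrediction ε x P →
      2 / 3 ≤ A.approxProb α (maxCut G) P σ

end StreamingAlgorithm

/-!
Both algorithms are deterministic; the only randomness is that of the predictions `Y`. They keep
counts along the stream from which each of the following numbers can be read off at the end, up to
an error of `η` times the number `m` of edges: the number of edges, the number of edges cut by `Y`,
the indicator of every edge, and for every vertex `v` its *agreement*, that is, the number of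
neighbours with the same predicted label minus the number of those with the opposite one. With
`errorRate r = τ` proportional to `ε²`, the output is as follows (`cutEstimate`).

* If `m` is at most a polynomial in `1 / ε`, then the estimated indicators of the edges, rounded,
  are exact. The graph is known, and its MAX-CUT value is returned.
* Otherwise, flipping the labels of a set `F` of at most `k` vertices changes the value of the
  predicted cut by the sum of the agreements of `F`, up to `2 k²` (`cutValue_flipOn`), which is
  negligible. Therefore the estimated value of the predicted cut plus the best estimated gain of
  such a set `F`, less `τ m` for the errors, is at most the MAX-CUT value, whatever `Y` is
  (`IsEstimate.cutEstimate_le`).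

For the lower bound (`IsEstimate.le_cutEstimate`) it is enough to exhibit one good set `F`: the
vertices of high degree with a wrong prediction. After the flip, the cut agrees with the optimal
cut `x` on the set `H` of vertices of high degree and with `Y` elsewhere. An edge with neither, one
or both endpoints in `H` has its sign under `x` scaled by `4ε²`, `2ε` or `1` in expectation. The
edges inside `H` are few, and the edges with one endpoint in `H` are on balance cut by `x`, as
otherwise flipping `H` would improve `x`; so the expected value is at least
`m / 2 + 2ε² (2 OPT - m)` up to a negligible term, and this is at least `(1/2 + 2ε²) OPT`
(`IsAccuratePrediction.integral_signSum_le`). Since only vertices of low degree have random labels,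
the variance is small, and Chebyshev's inequality applies
(`IsAccuratePrediction.two_thirds_le_measure`).

The counts are maintained by a Misra–Gries summary for insertion-only streams, with a number of
counters that does not depend on `n` (`misraGries_invariant`), and by a linear sketch for fully
dynamic streams: the items are hashed by all coordinates of a Reed–Solomon code, and as two
codewords rarely agree, the average of the counters of an item is close to its count
(`abs_hashEstimate_sub_le`, `exists_hash`).
-/

/-! ### Cuts as sums of signs -/

section Cuts

variable {n : ℕ}

/-- The product of the labels of the two endpoints of an edge: `-1` exactly if `x` cuts the edge. -/
def edgeSign (x : Fin n → ℤˣ) (e : Sym2 (Fin n)) : ℤˣ :=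
  Sym2.lift ⟨fun u v => x u * x v, fun u v => mul_comm (x u) (x v)⟩ e

@[simp]
theorem edgeSign_mk (x : Fin n → ℤˣ) (u v : Fin n) : edgeSign x s(u, v) = x u * x v := rfl

/-- The sum of the signs of the edges in `E`, that is, the number of uncut edges minus the number of
cut edges. -/
def signSum (E : Finset (Sym2 (Fin n))) (x : Fin n → ℤˣ) : ℤ :=
  ∑ e ∈ E, (edgeSign x e : ℤ)

/-- The sum of the signs of the edges at `v`: the change of the cut value if the label of `v` is
flipped. -/
def agreement (E : Finset (Sym2 (Fin n))) (x : Fin n → ℤˣ) (v : Fin n) : ℤ :=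
  ∑ e ∈ E with v ∈ e, (edgeSign x e : ℤ)

/-- The edges in `E` with both endpoints in `F`. -/
def innerEdges (E : Finset (Sym2 (Fin n))) (F : Finset (Fin n)) : Finset (Sym2 (Fin n)) :=
  {e ∈ E | ∀ v ∈ e, v ∈ F}

/-- The labelling `x` with the labels of the vertices in `F` flipped. -/
def flipOn (F : Finset (Fin n)) (x : Fin n → ℤˣ) : Fin n → ℤˣ :=
  fun v => if v ∈ F then -x v else x v

theorem card_innerEdges_le (E : Finset (Sym2 (Fin n))) (F : Finset (Fin n)) :
    (innerEdges E F).card ≤ F.card ^ 2 := by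
  have hsub : innerEdges E F ⊆ F.sym2 := by
    intro e he
    rw [innerEdges, Finset.mem_filter] at he
    exact Finset.mem_sym2_iff.2 he.2
  calc (innerEdges E F).card ≤ F.sym2.card := Finset.card_le_card hsub
    _ = (F.card + 1) * F.card / 2 := by
        rw [Finset.card_sym2, Nat.choose_two_right, Nat.add_sub_cancel]
    _ ≤ F.card ^ 2 := Nat.div_le_of_le_mul (by nlinarith [Nat.le_self_pow two_ne_zero F.card])

theorem abs_units_int_cast (s : ℤˣ) : |(s : ℤ)| = 1 := by
  rcases Int.units_eq_one_or s with rfl | rfl <;> simp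

theorem abs_sum_edgeSign_le (E : Finset (Sym2 (Fin n))) (x : Fin n → ℤˣ) :
    |∑ e ∈ E, (edgeSign x e : ℤ)| ≤ E.card := by
  refine (Finset.abs_sum_le_sum_abs _ _).trans ?_
  simp [abs_units_int_cast]

theorem abs_sum_innerEdges_le (E : Finset (Sym2 (Fin n))) (F : Finset (Fin n)) (x : Fin n → ℤˣ) :
    |∑ e ∈ innerEdges E F, (edgeSign x e : ℤ)| ≤ (F.card : ℤ) ^ 2 :=
  (abs_sum_edgeSign_le _ x).trans (by exact_mod_cast card_innerEdges_le E F)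

theorem sum_indicator_mem_edge (F : Finset (Fin n)) {a b : Fin n} (hab : a ≠ b) (c : ℤ) :
    ∑ v ∈ F, (if v ∈ s(a, b) then c else 0)
      = (if a ∈ F then c else 0) + (if b ∈ F then c else 0) := by
  have h : ∀ v, (if v ∈ s(a, b) then c else 0)
      = (if v = a then c else 0) + (if v = b then c else 0) := by
    intro v
    by_cases h1 : v = a
    · subst h1; simp [hab]
    · simp [h1]
  simp only [h, Finset.sum_add_distrib, Finset.sum_ite_eq']

theorem sum_agreement (E : Finset (Sym2 (Fin n))) (F : Finset (Fin n)) (x : Fin n → ℤˣ) :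
    ∑ v ∈ F, agreement E x v
      = ∑ e ∈ E, ∑ v ∈ F, (if v ∈ e then (edgeSign x e : ℤ) else 0) := by
  simp only [agreement, Finset.sum_filter]
  exact Finset.sum_comm

theorem signSum_flipOn {E : Finset (Sym2 (Fin n))} (hE : ∀ e ∈ E, ¬ e.IsDiag)
    (F : Finset (Fin n)) (x : Fin n → ℤˣ) :
    signSum E (flipOn F x) = signSum E x - 2 * ∑ v ∈ F, agreement E x v
      + 4 * ∑ e ∈ innerEdges E F, (edgeSign x e : ℤ) := by
  rw [sum_agreement, signSum, signSum, innerEdges, Finset.sum_filter, Finset.mul_sum,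
    Finset.mul_sum, ← Finset.sum_sub_distrib, ← Finset.sum_add_distrib]
  refine Finset.sum_congr rfl fun e he => ?_
  induction e with | _ a b => ?_
  have hab : a ≠ b := by simpa using hE _ he
  rw [sum_indicator_mem_edge F hab]
  by_cases ha : a ∈ F <;> by_cases hb : b ∈ F <;> simp [flipOn, ha, hb] <;> ring

theorem sum_agreement_univ {E : Finset (Sym2 (Fin n))} (hE : ∀ e ∈ E, ¬ e.IsDiag)
    (x : Fin n → ℤˣ) : ∑ v, agreement E x v = 2 * signSum E x := by
  rw [sum_agreement, signSum, Finset.mul_sum]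
  refine Finset.sum_congr rfl fun e he => ?_
  induction e with | _ a b => ?_
  have hab : a ≠ b := by simpa using hE _ he
  rw [sum_indicator_mem_edge _ hab]
  simp [two_mul]

theorem sum_card_incident {E : Finset (Sym2 (Fin n))} (hE : ∀ e ∈ E, ¬ e.IsDiag) :
    ∑ v, (E.filter (v ∈ ·)).card = 2 * E.card := by
  have h := sum_agreement_univ hE (fun _ => 1)
  have h1 : ∀ e : Sym2 (Fin n), edgeSign (fun _ => 1) e = 1 := by
    intro e
    induction e with | _ a b => simp
  simp only [agreement, signSum, h1] at h
  simp only [Units.val_one, Finset.sum_const, nsmul_eq_mul, mul_one] at h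
  exact_mod_cast h

open Classical in
/-- The edge set of `G`. -/
noncomputable def edges (G : SimpleGraph (Fin n)) : Finset (Sym2 (Fin n)) :=
  G.edgeFinset

theorem mem_edges {G : SimpleGraph (Fin n)} {e : Sym2 (Fin n)} : e ∈ edges G ↔ e ∈ G.edgeSet := by
  simp [edges]

theorem not_isDiag_of_mem_edges (G : SimpleGraph (Fin n)) : ∀ e ∈ edges G, ¬ e.IsDiag :=
  fun _ he => G.not_isDiag_of_mem_edgeSet (mem_edges.1 he)

theorem card_cut_eq_cutValue (G : SimpleGraph (Fin n)) (x : Fin n → ℤˣ) :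
    ((edges G).filter fun e => edgeSign x e = -1).card = cutValue G x := by
  classical
  symm
  unfold cutValue
  refine Finset.card_bij (fun p _ => s(p.1, p.2)) ?_ ?_ ?_
  · rintro ⟨u, v⟩ h
    simp only [Finset.mem_filter, Finset.mem_univ, true_and] at h
    simp [mem_edges, h.1, h.2.1, h.2.2]
  · rintro ⟨u, v⟩ h ⟨u', v'⟩ h' huv
    simp only [Finset.mem_filter, Finset.mem_univ, true_and] at h h'
    rcases Sym2.eq_iff.1 huv with ⟨rfl, rfl⟩ | ⟨rfl, rfl⟩
    · rfl
    · rw [h.2.1] at h'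
      exact absurd h'.2.2 (by decide)
  · intro e he
    induction e with | _ a b => ?_
    simp only [Finset.mem_filter, mem_edges, SimpleGraph.mem_edgeSet, edgeSign_mk] at he
    rcases Int.units_eq_one_or (x a) with ha | ha
    · exact ⟨(a, b), by simpa [ha] using he, rfl⟩
    · exact ⟨(b, a), by simpa [ha, G.adj_comm b a] using he, Sym2.eq_swap⟩

theorem two_mul_cutValue (G : SimpleGraph (Fin n)) (x : Fin n → ℤˣ) :
    2 * (cutValue G x : ℤ) = (edges G).card - signSum (edges G) x := by
  rw [← card_cut_eq_cutValue, Finset.card_filter, signSum, Finset.card_eq_sum_ones]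
  push_cast
  rw [Finset.mul_sum, ← Finset.sum_sub_distrib]
  refine Finset.sum_congr rfl fun e _ => ?_
  rcases Int.units_eq_one_or (edgeSign x e) with h | h <;> simp [h]

theorem cutValue_le_maxCut (G : SimpleGraph (Fin n)) (x : Fin n → ℤˣ) :
    cutValue G x ≤ maxCut G :=
  Finset.le_sup (f := fun x => cutValue G x) (Finset.mem_univ x)

theorem maxCut_le_card_edges (G : SimpleGraph (Fin n)) : maxCut G ≤ (edges G).card := by
  refine Finset.sup_le fun x _ => ?_
  rw [← card_cut_eq_cutValue]
  exact Finset.card_filter_le _ _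

theorem IsOptimalCut.signSum_le {G : SimpleGraph (Fin n)} {x : Fin n → ℤˣ} (hx : IsOptimalCut G x)
    (y : Fin n → ℤˣ) : signSum (edges G) x ≤ signSum (edges G) y := by
  have h1 := two_mul_cutValue G x
  have h2 := two_mul_cutValue G y
  have h3 := cutValue_le_maxCut G y
  rw [← hx] at h3
  omega

/-- Flipping all labels of `F` changes the cut value by the sum of the agreements, up to the
contribution of the edges inside `F`. -/
theorem cutValue_flipOn (G : SimpleGraph (Fin n)) (F : Finset (Fin n)) (y : Fin n → ℤˣ) :
    |(cutValue G (flipOn F y) : ℤ) - (cutValue G y + ∑ v ∈ F, agreement (edges G) y v)|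
      ≤ 2 * (F.card : ℤ) ^ 2 := by
  have h1 := two_mul_cutValue G y
  have h2 := two_mul_cutValue G (flipOn F y)
  have h3 := signSum_flipOn (not_isDiag_of_mem_edges G) F y
  have h4 := abs_le.1 (abs_sum_innerEdges_le (edges G) F y)
  rw [abs_le]
  constructor <;> omega

/-- In an optimal cut no vertex has more uncut than cut edges, so at least half of the edges are
cut. -/
theorem card_edges_le_two_mul_maxCut (G : SimpleGraph (Fin n)) {x : Fin n → ℤˣ}
    (hx : IsOptimalCut G x) : (edges G).card ≤ 2 * maxCut G := by
  have hv : ∀ v, agreement (edges G) x v ≤ 0 := by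
    intro v
    have h3 := signSum_flipOn (not_isDiag_of_mem_edges G) {v} x
    have h4 := hx.signSum_le (flipOn {v} x)
    have h5 : innerEdges (edges G) {v} = ∅ := by
      rw [innerEdges, Finset.filter_eq_empty_iff]
      intro e he h
      induction e with | _ a b => ?_
      refine not_isDiag_of_mem_edges G _ he ?_
      have ha := h a (by simp)
      have hb := h b (by simp)
      simp only [Finset.mem_singleton] at ha hb
      simp [ha, hb]
    rw [h5] at h3
    simp only [Finset.sum_singleton, Finset.sum_empty] at h3
    omega
  have h1 := sum_agreement_univ (not_isDiag_of_mem_edges G) x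
  have h2 : ∑ v, agreement (edges G) x v ≤ 0 := Finset.sum_nonpos fun v _ => hv v
  have h3 := two_mul_cutValue G x
  rw [hx] at h3
  omega

end Cuts

/-! ### The cut given by the predictions -/

section Predictions

variable {n : ℕ}

instance : DiscreteMeasurableSpace ℤˣ where
  forall_measurableSet s := ⟨Units.val '' s, trivial, Set.preimage_image_eq s Units.val_injective⟩

/-- The labelling that agrees with `x` on `H` and with `y` elsewhere. -/
def correctOn (H : Finset (Fin n)) (x y : Fin n → ℤˣ) : Fin n → ℤˣ :=
  fun v => if v ∈ H then x v else y v

theorem correctOn_eq_flipOn (H : Finset (Fin n)) (x y : Fin n → ℤˣ) :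
    correctOn H x y = flipOn {v ∈ H | y v ≠ x v} y := by
  funext v
  by_cases hv : v ∈ H <;> by_cases hy : y v = x v <;> simp [correctOn, flipOn, hv, hy]
  exact (Int.units_ne_iff_eq_neg.1 (Ne.symm hy))

variable {ε : ℝ} {x : Fin n → ℤˣ} {P : Measure (Fin n → ℤˣ)}

theorem memLp_of_finite [IsFiniteMeasure P] (f : (Fin n → ℤˣ) → ℝ) : MemLp f 2 P := by
  obtain ⟨C, hC⟩ := (Set.finite_range fun y => ‖f y‖).bddAbove
  exact MemLp.of_bound (Measurable.of_discrete).aestronglyMeasurable C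
    (Filter.Eventually.of_forall fun y => hC ⟨y, rfl⟩)

theorem integrable_of_finite [IsFiniteMeasure P] (f : (Fin n → ℤˣ) → ℝ) : Integrable f P :=
  (memLp_of_finite f).integrable one_le_two

/-- Functions of disjoint sets of predictions are independent. -/
theorem IsAccuratePrediction.indepFun_of_dependsOn (hP : IsAccuratePrediction ε x P)
    {f g : (Fin n → ℤˣ) → ℝ} {S T : Finset (Fin n)} (hST : Disjoint S T)
    (hf : DependsOn f S) (hg : DependsOn g T) : IndepFun f g P := by
  obtain ⟨f', rfl⟩ := dependsOn_iff_exists_comp.1 hf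
  obtain ⟨g', rfl⟩ := dependsOn_iff_exists_comp.1 hg
  exact (hP.indep.indepFun_finset S T hST fun _ => Measurable.of_discrete).comp
    (φ := f') (ψ := g') Measurable.of_discrete Measurable.of_discrete

theorem IsAccuratePrediction.integral_label (hP : IsAccuratePrediction ε x P) (hε : 0 ≤ ε)
    (hε' : ε ≤ 1 / 2) (v : Fin n) : ∫ y, (((y v : ℤˣ) : ℤ) : ℝ) ∂P = 2 * ε * ((x v : ℤ) : ℝ) := by
  have := hP.isProbabilityMeasure
  have h : ∀ y : Fin n → ℤˣ, (((y v : ℤˣ) : ℤ) : ℝ)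
      = Set.indicator {y | y v = x v} (fun _ => ((x v : ℤ) : ℝ)) y
        - Set.indicator {y | y v = -x v} (fun _ => ((x v : ℤ) : ℝ)) y := by
    intro y
    rcases Int.units_eq_one_or (y v) with hy | hy <;>
      rcases Int.units_eq_one_or (x v) with hx | hx <;>
      simp [Set.indicator, hx, hy]
  rw [integral_congr_ae (Filter.Eventually.of_forall h),
    integral_sub (integrable_of_finite _) (integrable_of_finite _),
    integral_indicator_const _ (MeasurableSet.of_discrete),
    integral_indicator_const _ (MeasurableSet.of_discrete), Measure.real, Measure.real, hP.correct,
    hP.incorrect, ENNReal.toReal_ofReal (by linarith), ENNReal.toReal_ofReal (by linarith)]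
  simp only [smul_eq_mul]
  ring

theorem dependsOn_correctOn (H : Finset (Fin n)) (x : Fin n → ℤˣ) (v : Fin n) :
    DependsOn (fun y => (((correctOn H x y v : ℤˣ) : ℤ) : ℝ)) (({v} \ H : Finset (Fin n)) : Set (Fin n)) := by
  intro y z h
  by_cases hv : v ∈ H
  · simp [correctOn, hv]
  · simp [correctOn, hv, h v (by simp [hv])]

theorem dependsOn_edgeSign (H : Finset (Fin n)) (x : Fin n → ℤˣ) (e : Sym2 (Fin n)) :
    DependsOn (fun y => ((edgeSign (correctOn H x y) e : ℤ) : ℝ))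
      ((Finset.univ.filter fun v => v ∈ e ∧ v ∉ H : Finset (Fin n)) : Set (Fin n)) := by
  intro y z h
  have hv : ∀ v ∈ e, correctOn H x y v = correctOn H x z v := by
    intro v hv
    by_cases hvH : v ∈ H
    · simp [correctOn, hvH]
    · simp [correctOn, hvH, h v (by simp [hv, hvH])]
  induction e with | _ a b => ?_
  simp [hv a (by simp), hv b (by simp)]

theorem IsAccuratePrediction.integral_correctOn (hP : IsAccuratePrediction ε x P) (hε : 0 ≤ ε)
    (hε' : ε ≤ 1 / 2) (H : Finset (Fin n)) (v : Fin n) :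
    ∫ y, (((correctOn H x y v : ℤˣ) : ℤ) : ℝ) ∂P
      = (if v ∈ H then 1 else 2 * ε) * ((x v : ℤ) : ℝ) := by
  have := hP.isProbabilityMeasure
  by_cases hv : v ∈ H
  · simp [correctOn, hv]
  · simpa [correctOn, hv] using hP.integral_label hε hε' v

/-- If `x` is optimal, then the predicted cut with the labels of `H` corrected inherits, in
expectation, at least a `4ε²` fraction of the surplus of cut over uncut edges of `x`, up to the edges inside
`H`. -/
theorem IsAccuratePrediction.integral_signSum_le (hP : IsAccuratePrediction ε x P) (hε : 0 ≤ ε)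
    (hε' : ε ≤ 1 / 2) {G : SimpleGraph (Fin n)} (hx : IsOptimalCut G x) (H : Finset (Fin n)) :
    ∫ y, (signSum (edges G) (correctOn H x y) : ℝ) ∂P
      ≤ 4 * ε ^ 2 * signSum (edges G) x + (H.card : ℝ) ^ 2 := by
  have := hP.isProbabilityMeasure
  -- The expected sign of an edge is its sign under `x`, scaled by `4ε²`, `2ε` or `1` according to
  -- the number of its endpoints in `H`; the edges with one endpoint in `H` are those whose sign
  -- changes if `H` is flipped.
  have he : ∀ e ∈ edges G, ∫ y, ((edgeSign (correctOn H x y) e : ℤ) : ℝ) ∂P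
      = 4 * ε ^ 2 * ((edgeSign x e : ℤ) : ℝ)
        + (ε - 2 * ε ^ 2) * (((edgeSign x e : ℤ) : ℝ) - ((edgeSign (flipOn H x) e : ℤ) : ℝ))
        + (1 - 4 * ε ^ 2) * (if ∀ v ∈ e, v ∈ H then ((edgeSign x e : ℤ) : ℝ) else 0) := by
    intro e he
    induction e with | _ a b => ?_
    have hab : a ≠ b := by simpa using not_isDiag_of_mem_edges G _ he
    have hind := hP.indepFun_of_dependsOn (S := {a} \ H) (T := {b} \ H)
      ((Finset.disjoint_singleton.2 hab).mono Finset.sdiff_subset Finset.sdiff_subset)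
      (dependsOn_correctOn H x a) (dependsOn_correctOn H x b)
    have hmul := hind.integral_mul_eq_mul_integral
      (integrable_of_finite _).aestronglyMeasurable (integrable_of_finite _).aestronglyMeasurable
    rw [hP.integral_correctOn hε hε', hP.integral_correctOn hε hε'] at hmul
    simp only [Pi.mul_apply] at hmul
    simp only [edgeSign_mk, Units.val_mul, Int.cast_mul]
    rw [hmul]
    by_cases ha : a ∈ H <;> by_cases hb : b ∈ H <;> simp [flipOn, ha, hb] <;> ring
  have hsum : ∫ y, (signSum (edges G) (correctOn H x y) : ℝ) ∂P
      = 4 * ε ^ 2 * signSum (edges G) x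
        + (ε - 2 * ε ^ 2) * (signSum (edges G) x - signSum (edges G) (flipOn H x))
        + (1 - 4 * ε ^ 2) * (∑ e ∈ innerEdges (edges G) H, (edgeSign x e : ℤ) : ℤ) := by
    simp only [signSum, Int.cast_sum]
    rw [integral_finsetSum _ fun _ _ => integrable_of_finite _, Finset.sum_congr rfl he,
      Finset.sum_add_distrib, Finset.sum_add_distrib, innerEdges, Finset.sum_filter,
      ← Finset.mul_sum, ← Finset.mul_sum, ← Finset.mul_sum, Finset.sum_sub_distrib]
  have hflip : (signSum (edges G) x : ℝ) ≤ signSum (edges G) (flipOn H x) := by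
    exact_mod_cast hx.signSum_le _
  have hin : ((∑ e ∈ innerEdges (edges G) H, (edgeSign x e : ℤ) : ℤ) : ℝ) ≤ (H.card : ℝ) ^ 2 := by
    exact_mod_cast (abs_le.1 (abs_sum_innerEdges_le (edges G) H x)).2
  have hinner : (1 - 4 * ε ^ 2) * ((∑ e ∈ innerEdges (edges G) H, (edgeSign x e : ℤ) : ℤ) : ℝ)
      ≤ (H.card : ℝ) ^ 2 := by
    have h4 : 0 ≤ 1 - 4 * ε ^ 2 := by nlinarith
    calc _ ≤ (1 - 4 * ε ^ 2) * (H.card : ℝ) ^ 2 := mul_le_mul_of_nonneg_left hin h4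
      _ ≤ 1 * (H.card : ℝ) ^ 2 := by gcongr; nlinarith
      _ = _ := one_mul _
  have hcross : (ε - 2 * ε ^ 2)
      * ((signSum (edges G) x : ℝ) - signSum (edges G) (flipOn H x)) ≤ 0 :=
    mul_nonpos_of_nonneg_of_nonpos (by nlinarith) (by linarith)
  rw [hsum]
  linarith

theorem abs_edgeSign_cast (y : Fin n → ℤˣ) (e : Sym2 (Fin n)) :
    |((edgeSign y e : ℤ) : ℝ)| = 1 := by
  exact_mod_cast abs_units_int_cast (edgeSign y e)

theorem abs_integral_le_one [IsProbabilityMeasure P] {f : (Fin n → ℤˣ) → ℝ}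
    (hf : ∀ y, |f y| ≤ 1) : |∫ y, f y ∂P| ≤ 1 := by
  simpa using norm_integral_le_of_norm_le_const (μ := P) (f := f) (C := 1)
    (Filter.Eventually.of_forall hf)

/-- Signs of edges that share no vertex outside `H` are uncorrelated. -/
theorem IsAccuratePrediction.covariance_edgeSign_le (hP : IsAccuratePrediction ε x P)
    (H : Finset (Fin n)) (e e' : Sym2 (Fin n)) :
    cov[fun y => ((edgeSign (correctOn H x y) e : ℤ) : ℝ),
        fun y => ((edgeSign (correctOn H x y) e' : ℤ) : ℝ); P]
      ≤ ∑ v ∈ Hᶜ, if v ∈ e ∧ v ∈ e' then 2 else 0 := by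
  have := hP.isProbabilityMeasure
  by_cases h : ∃ v ∈ Hᶜ, v ∈ e ∧ v ∈ e'
  · obtain ⟨v, hvH, hv⟩ := h
    have h2 : (2 : ℝ) ≤ ∑ v ∈ Hᶜ, if v ∈ e ∧ v ∈ e' then 2 else 0 := by
      refine le_trans (by simp [hv]) (Finset.single_le_sum
        (f := fun v => if v ∈ e ∧ v ∈ e' then (2 : ℝ) else 0) (fun _ _ => by positivity) hvH)
    refine le_trans ?_ h2
    rw [covariance_eq_sub (memLp_of_finite _) (memLp_of_finite _)]
    have h3 := abs_integral_le_one (P := P)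
      (f := (fun y => ((edgeSign (correctOn H x y) e : ℤ) : ℝ))
        * fun y => ((edgeSign (correctOn H x y) e' : ℤ) : ℝ))
      fun y => by simp [abs_mul, abs_edgeSign_cast]
    have h4 := abs_integral_le_one (P := P)
      (f := fun y => ((edgeSign (correctOn H x y) e : ℤ) : ℝ)) fun y => (abs_edgeSign_cast _ _).le
    have h5 := abs_integral_le_one (P := P)
      (f := fun y => ((edgeSign (correctOn H x y) e' : ℤ) : ℝ)) fun y => (abs_edgeSign_cast _ _).le
    have h6 := abs_le.1 ((abs_mul _ _).trans_le (mul_le_one₀ h4 (abs_nonneg _) h5))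
    linarith [(abs_le.1 h3).2, h6.1]
  · have hd : Disjoint (Finset.univ.filter fun v => v ∈ e ∧ v ∉ H)
        (Finset.univ.filter fun v => v ∈ e' ∧ v ∉ H) := by
      rw [Finset.disjoint_left]
      intro v hv hv'
      simp only [Finset.mem_filter, Finset.mem_univ, true_and] at hv hv'
      exact h ⟨v, by simpa using hv.2, hv.1, hv'.1⟩
    rw [(hP.indepFun_of_dependsOn hd (dependsOn_edgeSign H x e)
      (dependsOn_edgeSign H x e')).covariance_eq_zero (memLp_of_finite _) (memLp_of_finite _)]
    exact Finset.sum_nonneg fun _ _ => by positivity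

/-- Only pairs of edges that share a vertex outside `H` contribute to the variance. -/
theorem IsAccuratePrediction.variance_signSum_le (hP : IsAccuratePrediction ε x P)
    (E : Finset (Sym2 (Fin n))) (H : Finset (Fin n)) :
    Var[fun y => (signSum E (correctOn H x y) : ℝ); P]
      ≤ 2 * ∑ v ∈ Hᶜ, ((E.filter (v ∈ ·)).card : ℝ) ^ 2 := by
  have := hP.isProbabilityMeasure
  simp only [signSum, Int.cast_sum]
  rw [variance_fun_sum' fun _ _ => memLp_of_finite _]
  calc _ ≤ ∑ e ∈ E, ∑ e' ∈ E, ∑ v ∈ Hᶜ, (if v ∈ e ∧ v ∈ e' then (2 : ℝ) else 0) :=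
        Finset.sum_le_sum fun e _ => Finset.sum_le_sum fun e' _ =>
          hP.covariance_edgeSign_le H e e'
    _ = ∑ v ∈ Hᶜ, ∑ e ∈ E, ∑ e' ∈ E, (if v ∈ e ∧ v ∈ e' then (2 : ℝ) else 0) := by
        rw [Finset.sum_comm (s := Hᶜ)]
        exact Finset.sum_congr rfl fun e _ => Finset.sum_comm
    _ = _ := by
        rw [Finset.mul_sum]
        refine Finset.sum_congr rfl fun v _ => ?_
        have h : ∀ e e' : Sym2 (Fin n), (if v ∈ e ∧ v ∈ e' then (2 : ℝ) else 0)
            = 2 * ((if v ∈ e then 1 else 0) * (if v ∈ e' then 1 else 0)) := by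
          intro e e'
          by_cases h1 : v ∈ e <;> by_cases h2 : v ∈ e' <;> simp [h1, h2]
        simp only [h, ← Finset.mul_sum, ← Finset.sum_mul, Finset.sum_boole]
        ring

/-- The vertices that are incident to more than `δ * |E|` edges in `E`. -/
noncomputable def heavyVertices (E : Finset (Sym2 (Fin n))) (δ : ℝ) : Finset (Fin n) :=
  {v | δ * E.card < (E.filter (v ∈ ·)).card}

theorem card_heavyVertices_le {E : Finset (Sym2 (Fin n))} (hE : ∀ e ∈ E, ¬ e.IsDiag) {δ : ℝ}
    (hδ : 0 < δ) : (heavyVertices E δ).card ≤ 2 / δ := by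
  rcases Finset.eq_empty_or_nonempty E with rfl | hne
  · simp [heavyVertices]; positivity
  have hpos : (0 : ℝ) < E.card := by exact_mod_cast hne.card_pos
  have h1 : (heavyVertices E δ).card * (δ * E.card) ≤ 2 * E.card := by
    calc (heavyVertices E δ).card * (δ * E.card)
        = ∑ v ∈ heavyVertices E δ, δ * (E.card : ℝ) := by simp
      _ ≤ ∑ v ∈ heavyVertices E δ, ((E.filter (v ∈ ·)).card : ℝ) :=
          Finset.sum_le_sum fun v hv => by
            simp only [heavyVertices, Finset.mem_filter] at hv
            exact hv.2.le
      _ ≤ ∑ v, ((E.filter (v ∈ ·)).card : ℝ) :=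
          Finset.sum_le_sum_of_subset_of_nonneg (Finset.subset_univ _)
            fun _ _ _ => Nat.cast_nonneg _
      _ = 2 * E.card := by exact_mod_cast sum_card_incident hE
  rw [le_div_iff₀ hδ]
  exact le_of_mul_le_mul_right (by linarith) hpos

/-- With the labels of the heavy vertices corrected, the value of the predicted cut is unlikely to be
much less than its expectation. -/
theorem IsAccuratePrediction.two_thirds_le_measure (hP : IsAccuratePrediction ε x P)
    (hε : 0 ≤ ε) (hε' : ε ≤ 1 / 2) {G : SimpleGraph (Fin n)} (hx : IsOptimalCut G x) {τ : ℝ}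
    (hτ : 0 < τ) :
    2 / 3 ≤ P {y | (signSum (edges G) (correctOn (heavyVertices (edges G) (τ ^ 2 / 3)) x y) : ℝ)
      ≤ 4 * ε ^ 2 * signSum (edges G) x + ((heavyVertices (edges G) (τ ^ 2 / 3)).card : ℝ) ^ 2
        + 2 * τ * (edges G).card} := by
  have := hP.isProbabilityMeasure
  set H := heavyVertices (edges G) (τ ^ 2 / 3) with hH
  set V : (Fin n → ℤˣ) → ℝ := fun y => (signSum (edges G) (correctOn H x y) : ℝ) with hV
  have hexp : ∫ y, V y ∂P ≤ _ := hP.integral_signSum_le hε hε' hx H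
  rcases Finset.eq_empty_or_nonempty (edges G) with hempty | hne
  · have huniv : {y | V y ≤ 4 * ε ^ 2 * signSum (edges G) x + (H.card : ℝ) ^ 2
        + 2 * τ * (edges G).card} = Set.univ := by
      refine Set.eq_univ_of_forall fun y => ?_
      simp only [hV, hempty, signSum, Finset.sum_empty, Set.mem_ofPred_eq, Finset.card_empty]
      simp
    rw [huniv, measure_univ]
    exact ENNReal.div_le_of_le_mul (by norm_num)
  have hm : (0 : ℝ) < (edges G).card := by exact_mod_cast hne.card_pos
  have hvar : Var[V; P] ≤ 4 * (τ ^ 2 / 3) * ((edges G).card : ℝ) ^ 2 := by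
    refine (hP.variance_signSum_le (edges G) H).trans ?_
    have h1 : ∑ v ∈ Hᶜ, (((edges G).filter (v ∈ ·)).card : ℝ) ^ 2
        ≤ ∑ v ∈ Hᶜ, τ ^ 2 / 3 * (edges G).card * (((edges G).filter (v ∈ ·)).card : ℝ) := by
      refine Finset.sum_le_sum fun v hv => ?_
      rw [sq]
      refine mul_le_mul_of_nonneg_right ?_ (Nat.cast_nonneg _)
      simpa [hH, heavyVertices] using hv
    have h2 : ∑ v ∈ Hᶜ, (((edges G).filter (v ∈ ·)).card : ℝ) ≤ 2 * (edges G).card := by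
      refine (Finset.sum_le_sum_of_subset_of_nonneg (Finset.subset_univ _)
        fun _ _ _ => Nat.cast_nonneg _).trans_eq ?_
      exact_mod_cast sum_card_incident (not_isDiag_of_mem_edges G)
    rw [← Finset.mul_sum] at h1
    have h3 := mul_le_mul_of_nonneg_left h2
      (show 0 ≤ τ ^ 2 / 3 * ((edges G).card : ℝ) by positivity)
    nlinarith
  have hc : 0 < 2 * τ * (edges G).card := by positivity
  have hcheb := meas_ge_le_variance_div_sq (μ := P) (memLp_of_finite V) hc
  have hratio : Var[V; P] / (2 * τ * (edges G).card) ^ 2 ≤ 1 / 3 := by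
    rw [div_le_iff₀ (by positivity)]
    linarith
  have hbad : P {y | 2 * τ * (edges G).card ≤ |V y - ∫ y, V y ∂P|} ≤ 1 / 3 := by
    refine hcheb.trans ((ENNReal.ofReal_le_ofReal hratio).trans_eq ?_)
    rw [ENNReal.ofReal_div_of_pos (by norm_num)]
    simp
  have hsub : {y | 2 * τ * (edges G).card ≤ |V y - ∫ y, V y ∂P|}ᶜ
      ⊆ {y | V y ≤ 4 * ε ^ 2 * signSum (edges G) x + (H.card : ℝ) ^ 2
        + 2 * τ * (edges G).card} := by
    intro y hy
    simp only [Set.mem_compl_iff, Set.mem_ofPred_eq, not_le] at hy ⊢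
    linarith [(abs_lt.1 hy).2]
  refine le_trans ?_ (measure_mono hsub)
  rw [prob_compl_eq_one_sub MeasurableSet.of_discrete]
  calc (2 / 3 : ENNReal) = 1 - 1 / 3 := by
        rw [← ENNReal.toReal_eq_toReal_iff' (by finiteness) (by finiteness),
          ENNReal.toReal_sub_of_le (ENNReal.div_le_of_le_mul (by norm_num)) (by finiteness)]
        norm_num
    _ ≤ _ := tsub_le_tsub_left hbad _

end Predictions

/-! ### Estimating the MAX-CUT value from approximate counts -/

section Estimator

variable {n : ℕ}

/-- The quantities that are counted along the stream: for `(v, s)` the edges of sign `s` at the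
vertex `v`, for an edge its multiplicity, and for a sign `s` all edges of that sign. -/
abbrev Item (n : ℕ) : Type := (Fin n × ℤˣ) ⊕ (Sym2 (Fin n) ⊕ ℤˣ)

/-- The contribution of the edge `e` to the count `i`, given the predictions `Y`. -/
def incidence (Y : Fin n → ℤˣ) (e : Sym2 (Fin n)) : Item n → ℕ
  | .inl (v, s) => if v ∈ e ∧ edgeSign Y e = s then 1 else 0
  | .inr (.inl e') => if e = e' then 1 else 0
  | .inr (.inr s) => if edgeSign Y e = s then 1 else 0

/-- The value of the count `i` on the edge set `E`. -/
def itemCount (E : Finset (Sym2 (Fin n))) (Y : Fin n → ℤˣ) (i : Item n) : ℤ :=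
  ∑ e ∈ E, (incidence Y e i : ℤ)

theorem itemCount_edge (E : Finset (Sym2 (Fin n))) (Y : Fin n → ℤˣ) (e : Sym2 (Fin n)) :
    itemCount E Y (.inr (.inl e)) = if e ∈ E then 1 else 0 := by
  simp [itemCount, incidence]

theorem itemCount_sign_neg_one (G : SimpleGraph (Fin n)) (Y : Fin n → ℤˣ) :
    itemCount (edges G) Y (.inr (.inr (-1))) = cutValue G Y := by
  simp [itemCount, incidence, ← card_cut_eq_cutValue]

theorem itemCount_sign_add (E : Finset (Sym2 (Fin n))) (Y : Fin n → ℤˣ) :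
    itemCount E Y (.inr (.inr 1)) + itemCount E Y (.inr (.inr (-1))) = E.card := by
  rw [itemCount, itemCount, ← Finset.sum_add_distrib, Finset.card_eq_sum_ones, Nat.cast_sum]
  refine Finset.sum_congr rfl fun e _ => ?_
  rcases Int.units_eq_one_or (edgeSign Y e) with h | h <;> simp [incidence, h]

theorem itemCount_vertex_sub (E : Finset (Sym2 (Fin n))) (Y : Fin n → ℤˣ) (v : Fin n) :
    itemCount E Y (.inl (v, 1)) - itemCount E Y (.inl (v, -1)) = agreement E Y v := by
  rw [itemCount, itemCount, ← Finset.sum_sub_distrib, agreement, Finset.sum_filter]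
  refine Finset.sum_congr rfl fun e _ => ?_
  by_cases hv : v ∈ e <;> rcases Int.units_eq_one_or (edgeSign Y e) with h | h <;>
    simp [incidence, h, hv]

/-- The estimated number of edges. -/
def edgeEstimate (est : Item n → ℝ) : ℝ :=
  est (.inr (.inr 1)) + est (.inr (.inr (-1)))

/-- The estimated gain in the value of the predicted cut from flipping the vertices in `F`, if the
edges inside `F` are neglected. -/
def gainEstimate (est : Item n → ℝ) (F : Finset (Fin n)) : ℝ :=
  ∑ v ∈ F, (est (.inl (v, 1)) - est (.inl (v, -1)))

theorem nonempty_filter_card_le (n k : ℕ) :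
    ((Finset.univ : Finset (Finset (Fin n))).filter (·.card ≤ k)).Nonempty :=
  ⟨∅, by simp⟩

open Classical in
/-- The output of the algorithms. If at most `M` edges are present, the estimates identify the
graph. Otherwise, the output is the estimated value of the predicted cut plus the best gain from
flipping at most `k` vertices, less a fraction `τ` of the number of edges, which makes up for the
errors. -/
noncomputable def cutEstimate (k M : ℕ) (τ : ℝ) (est : Item n → ℝ) : ℝ :=
  if edgeEstimate est ≤ M then
    maxCut (SimpleGraph.fromEdgeSet {e | 1 / 2 < est (.inr (.inl e))})
  else
    est (.inr (.inr (-1)))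
      + ((Finset.univ : Finset (Finset (Fin n))).filter (·.card ≤ k)).sup'
        (nonempty_filter_card_le n k) (gainEstimate est)
      - τ * edgeEstimate est

/-- All estimates have an error of at most `η` times the number of edges. -/
def IsEstimate (η : ℝ) (G : SimpleGraph (Fin n)) (Y : Fin n → ℤˣ) (est : Item n → ℝ) : Prop :=
  ∀ i, |est i - itemCount (edges G) Y i| ≤ η * (edges G).card

variable {G : SimpleGraph (Fin n)} {Y : Fin n → ℤˣ} {est : Item n → ℝ} {η : ℝ}

theorem IsEstimate.abs_edgeEstimate_sub_le (h : IsEstimate η G Y est) :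
    |edgeEstimate est - (edges G).card| ≤ 2 * (η * (edges G).card) := by
  have h1 := abs_le.1 (h (.inr (.inr 1)))
  have h2 := abs_le.1 (h (.inr (.inr (-1))))
  have h3 : (itemCount (edges G) Y (.inr (.inr 1)) : ℝ)
      + itemCount (edges G) Y (.inr (.inr (-1))) = (edges G).card := by
    exact_mod_cast itemCount_sign_add (edges G) Y
  rw [edgeEstimate, abs_le]
  constructor <;> linarith

theorem IsEstimate.abs_gainEstimate_sub_le (h : IsEstimate η G Y est) (F : Finset (Fin n)) :
    |gainEstimate est F - ∑ v ∈ F, (agreement (edges G) Y v : ℝ)|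
      ≤ F.card * (2 * (η * (edges G).card)) := by
  rw [gainEstimate, ← Finset.sum_sub_distrib, ← nsmul_eq_mul, ← Finset.sum_const]
  refine (Finset.abs_sum_le_sum_abs _ _).trans (Finset.sum_le_sum fun v _ => ?_)
  have h1 := abs_le.1 (h (.inl (v, 1)))
  have h2 := abs_le.1 (h (.inl (v, -1)))
  have h3 : (itemCount (edges G) Y (.inl (v, 1)) : ℝ)
      - itemCount (edges G) Y (.inl (v, -1)) = agreement (edges G) Y v := by
    exact_mod_cast itemCount_vertex_sub (edges G) Y v
  rw [abs_le]
  constructor <;> linarith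

/-- Adding the estimated gain of `F` to the estimated value of the predicted cut estimates the value
of the predicted cut with `F` flipped. -/
theorem IsEstimate.abs_add_gainEstimate_sub_le (h : IsEstimate η G Y est) (hη : 0 ≤ η) {k : ℕ}
    {F : Finset (Fin n)} (hF : F.card ≤ k) :
    |est (.inr (.inr (-1))) + gainEstimate est F - cutValue G (flipOn F Y)|
      ≤ (2 * k + 1) * (η * (edges G).card) + 2 * (k : ℝ) ^ 2 := by
  have h1 := abs_le.1 (h (.inr (.inr (-1))))
  rw [itemCount_sign_neg_one] at h1
  have h2 := abs_le.1 (h.abs_gainEstimate_sub_le F)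
  have h3 : |(cutValue G (flipOn F Y) : ℝ)
      - (cutValue G Y + ∑ v ∈ F, (agreement (edges G) Y v : ℝ))| ≤ 2 * (F.card : ℝ) ^ 2 := by
    exact_mod_cast cutValue_flipOn G F Y
  have h4 := abs_le.1 h3
  have hFk : (F.card : ℝ) ≤ k := by exact_mod_cast hF
  have h5 : (F.card : ℝ) * (2 * (η * (edges G).card)) ≤ k * (2 * (η * (edges G).card)) := by gcongr
  have h6 : 2 * (F.card : ℝ) ^ 2 ≤ 2 * (k : ℝ) ^ 2 := by gcongr
  push_cast at h1
  rw [abs_le]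
  constructor <;> nlinarith

theorem IsEstimate.cutEstimate_of_le (h : IsEstimate η G Y est) {k M : ℕ} {τ : ℝ} (hM : 0 < M)
    (hη : η * (8 * M) = 1) (hle : edgeEstimate est ≤ M) : cutEstimate k M τ est = maxCut G := by
  have hη0 : 0 < η := by
    have : (0 : ℝ) < M := by exact_mod_cast hM
    by_contra hneg
    nlinarith
  have hM1 : (1 : ℝ) ≤ M := by exact_mod_cast hM
  have h1 := abs_le.1 h.abs_edgeEstimate_sub_le
  have hη1 : η ≤ 1 / 8 := by nlinarith
  have hm : ((edges G).card : ℝ) ≤ 2 * M := by nlinarith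
  have herr : η * (edges G).card < 1 / 2 := by nlinarith
  rw [cutEstimate, if_pos hle]
  congr 2
  rw [← SimpleGraph.fromEdgeSet_edgeSet G]
  congr 1
  ext e
  have h2 := abs_le.1 (h (.inr (.inl e)))
  rw [itemCount_edge] at h2
  rw [Set.mem_ofPred_eq, ← mem_edges]
  by_cases he : e ∈ edges G
  · simp only [he, if_true, Int.cast_one] at h2
    simp only [he, iff_true]
    linarith
  · simp only [he, if_false, Int.cast_zero] at h2
    simp only [he, iff_false, not_lt]
    linarith

/-- The parameter `k` of `cutEstimate`, for predictions of accuracy `1 / r`: a bound on the number of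
vertices of high degree. -/
def flipBound (r : ℕ) : ℕ := 864 * r ^ 4

/-- The parameter `M` of `cutEstimate`, for predictions of accuracy `1 / r`, chosen such that `2 k²`
is small compared to `τ M`. -/
def sparseBound (r : ℕ) : ℕ := 192 * flipBound r ^ 2 * r ^ 2

/-- The parameter `τ` of `cutEstimate`, for predictions of accuracy `1 / r`. -/
noncomputable def errorRate (r : ℕ) : ℝ := 1 / (12 * r ^ 2)

theorem errorRate_mul_sparseBound {r : ℕ} (hr : 0 < r) :
    errorRate r * sparseBound r = 16 * (flipBound r : ℝ) ^ 2 := by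
  have : (r : ℝ) ≠ 0 := by positivity
  rw [errorRate, sparseBound]
  push_cast
  field_simp
  ring

theorem flipBound_pos {r : ℕ} (hr : 0 < r) : 0 < flipBound r := by
  unfold flipBound; positivity

theorem sparseBound_pos {r : ℕ} (hr : 0 < r) : 0 < sparseBound r := by
  have := flipBound_pos hr
  unfold sparseBound; positivity

/-- Above the sparse regime, all errors together are a `τ` fraction of the number of edges. -/
theorem IsEstimate.error_le (h : IsEstimate η G Y est) {r : ℕ} (hr : 0 < r)
    (hη : η * (8 * sparseBound r) = 1) (hgt : (sparseBound r : ℝ) < edgeEstimate est) :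
    (2 * flipBound r + 1) * (η * (edges G).card) + 2 * (flipBound r : ℝ) ^ 2
        ≤ errorRate r * edgeEstimate est ∧
      errorRate r * edgeEstimate est ≤ 2 * errorRate r * (edges G).card ∧
      2 * (flipBound r : ℝ) ^ 2 ≤ errorRate r * (edges G).card / 4 := by
  have hk : (1 : ℝ) ≤ flipBound r := by exact_mod_cast flipBound_pos hr
  have hM : (1 : ℝ) ≤ sparseBound r := by exact_mod_cast sparseBound_pos hr
  have hτ : 0 < errorRate r := by unfold errorRate; positivity
  have hτM := errorRate_mul_sparseBound hr
  have hη0 : 0 < η := by by_contra hneg; nlinarith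
  have hη1 : η ≤ 1 / 8 := by nlinarith
  have h1 := abs_le.1 h.abs_edgeEstimate_sub_le
  have hm : (0 : ℝ) ≤ (edges G).card := Nat.cast_nonneg _
  have hηm : η * (edges G).card ≤ (edges G).card / 8 := by nlinarith
  have hmM : (sparseBound r : ℝ) / 2 ≤ (edges G).card := by linarith
  have hk2 : 2 * (flipBound r : ℝ) ^ 2 ≤ errorRate r * (edges G).card / 4 := by nlinarith
  have hητ : η * (128 * (flipBound r : ℝ) ^ 2) = errorRate r := by
    rw [← mul_one (errorRate r), ← hη]
    linear_combination (-8 * η) * hτM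
  have hkη : (2 * flipBound r + 1) * η ≤ errorRate r / 8 := by nlinarith
  have hkηm : (2 * flipBound r + 1) * (η * (edges G).card)
      ≤ errorRate r / 8 * (edges G).card := by
    rw [← mul_assoc]
    exact mul_le_mul_of_nonneg_right hkη hm
  refine ⟨?_, ?_, hk2⟩
  · nlinarith
  · nlinarith

/-- The output never exceeds the MAX-CUT value. -/
theorem IsEstimate.cutEstimate_le (h : IsEstimate η G Y est) {r : ℕ} (hr : 0 < r)
    (hη : η * (8 * sparseBound r) = 1) :
    cutEstimate (flipBound r) (sparseBound r) (errorRate r) est ≤ maxCut G := by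
  rcases le_or_gt (edgeEstimate est) (sparseBound r) with hle | hgt
  · exact (h.cutEstimate_of_le (sparseBound_pos hr) hη hle).le
  have hη0 : 0 ≤ η := by
    have : (0 : ℝ) < sparseBound r := by exact_mod_cast sparseBound_pos hr
    by_contra hneg
    nlinarith
  obtain ⟨h1, -, -⟩ := h.error_le hr hη hgt
  rw [cutEstimate, if_neg hgt.not_ge]
  suffices hsup : ((Finset.univ : Finset (Finset (Fin n))).filter (·.card ≤ flipBound r)).sup'
      (nonempty_filter_card_le n _) (gainEstimate est)
      ≤ maxCut G + errorRate r * edgeEstimate est - est (.inr (.inr (-1))) by linarith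
  refine Finset.sup'_le _ _ fun F hF => ?_
  have h2 := abs_le.1 (h.abs_add_gainEstimate_sub_le hη0 (Finset.mem_filter.1 hF).2)
  have h3 : (cutValue G (flipOn F Y) : ℝ) ≤ maxCut G := by
    exact_mod_cast cutValue_le_maxCut G _
  linarith

theorem card_heavyVertices_le_flipBound {r : ℕ} (hr : 0 < r) :
    (heavyVertices (edges G) (errorRate r ^ 2 / 3)).card ≤ flipBound r := by
  have hτ : 0 < errorRate r := by unfold errorRate; positivity
  have h := card_heavyVertices_le (not_isDiag_of_mem_edges G)
    (show 0 < errorRate r ^ 2 / 3 by positivity)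
  have h2 : 2 / (errorRate r ^ 2 / 3) = flipBound r := by
    rw [errorRate, flipBound]
    push_cast
    field_simp
    norm_num
  rw [h2] at h
  exact_mod_cast h

/-- If the predicted cut, with the labels of the heavy vertices corrected, has at least about its
expected value, then the output is an approximation from below. -/
theorem IsEstimate.le_cutEstimate (h : IsEstimate η G Y est) {r : ℕ} (hr : 0 < r)
    (hη : η * (8 * sparseBound r) = 1) {x : Fin n → ℤˣ} (hx : IsOptimalCut G x) {ε : ℝ}
    (hε' : ε ≤ 1 / 2) (hrε : 1 / (r : ℝ) ≤ ε)
    (hY : (signSum (edges G)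
        (correctOn (heavyVertices (edges G) (errorRate r ^ 2 / 3)) x Y) : ℝ)
      ≤ 4 * ε ^ 2 * signSum (edges G) x
        + ((heavyVertices (edges G) (errorRate r ^ 2 / 3)).card : ℝ) ^ 2
        + 2 * errorRate r * (edges G).card) :
    (1 / 2 + ε ^ 2) * maxCut G
      ≤ cutEstimate (flipBound r) (sparseBound r) (errorRate r) est := by
  have hr' : (0 : ℝ) < 1 / r := by positivity
  rcases le_or_gt (edgeEstimate est) (sparseBound r) with hle | hgt
  · rw [h.cutEstimate_of_le (sparseBound_pos hr) hη hle]
    have h0 : (0 : ℝ) ≤ maxCut G := Nat.cast_nonneg _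
    have hε2 : ε ^ 2 ≤ 1 / 2 := by nlinarith
    nlinarith
  have hη0 : 0 ≤ η := by
    have : (0 : ℝ) < sparseBound r := by exact_mod_cast sparseBound_pos hr
    by_contra hneg
    nlinarith
  obtain ⟨h1, h2, h3⟩ := h.error_le hr hη hgt
  rw [cutEstimate, if_neg hgt.not_ge]
  rw [correctOn_eq_flipOn] at hY
  set H := heavyVertices (edges G) (errorRate r ^ 2 / 3) with hH
  have hHk : H.card ≤ flipBound r := card_heavyVertices_le_flipBound hr
  set F : Finset (Fin n) := {v ∈ H | Y v ≠ x v} with hF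
  have hFk : F.card ≤ flipBound r := (Finset.card_filter_le _ _).trans hHk
  have hsup := Finset.le_sup' (gainEstimate est) (b := F)
    (s := (Finset.univ : Finset (Finset (Fin n))).filter (·.card ≤ flipBound r)) (by simp [hFk])
  have h4 := abs_le.1 (h.abs_add_gainEstimate_sub_le hη0 hFk)
  have h5 : 2 * (cutValue G (flipOn F Y) : ℝ)
      = (edges G).card - signSum (edges G) (flipOn F Y) := by
    exact_mod_cast two_mul_cutValue G _
  have h6 : 2 * (maxCut G : ℝ) = (edges G).card - signSum (edges G) x := by
    rw [← hx]
    exact_mod_cast two_mul_cutValue G x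
  have h7 : ((edges G).card : ℝ) ≤ 2 * maxCut G := by
    exact_mod_cast card_edges_le_two_mul_maxCut G hx
  have h8 : (maxCut G : ℝ) ≤ (edges G).card := by exact_mod_cast maxCut_le_card_edges G
  have h9 : (H.card : ℝ) ^ 2 ≤ (flipBound r : ℝ) ^ 2 := by
    have : (H.card : ℝ) ≤ flipBound r := by exact_mod_cast hHk
    gcongr
  have hτε : 12 * errorRate r ≤ ε ^ 2 := by
    calc 12 * errorRate r = (1 / r) ^ 2 := by
          rw [errorRate]
          field_simp
      _ ≤ ε ^ 2 := by gcongr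
  have hm : (0 : ℝ) ≤ (edges G).card := Nat.cast_nonneg _
  have h10 : errorRate r * (edges G).card * 6 ≤ ε ^ 2 * maxCut G := by
    have := mul_le_mul_of_nonneg_right hτε hm
    nlinarith [sq_nonneg ε]
  have h11 : 0 ≤ (1 / 2 - 2 * ε ^ 2) * ((edges G).card - maxCut G : ℝ) :=
    mul_nonneg (by nlinarith) (by linarith)
  have h12 : signSum (edges G) x = ((edges G).card : ℝ) - 2 * maxCut G := by linarith
  rw [h12] at hY
  nlinarith

end Estimator

/-! ### Counts along a stream -/

section Streams

variable {n : ℕ}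

/-- The items whose counts are changed by a stream element. -/
def AnnotatedUpdate.items (a : AnnotatedUpdate n) : List (Item n) :=
  [.inl (a.u, a.Yu * a.Yv), .inl (a.v, a.Yu * a.Yv), .inr (.inl s(a.u, a.v)),
    .inr (.inr (a.Yu * a.Yv))]

/-- The net count of the item `i` after the stream `L`. -/
def streamCount (L : List (AnnotatedUpdate n)) (i : Item n) : ℤ :=
  (L.map fun a => (a.Δ : ℤ) * ((a.items.countP (· = i) : ℕ) : ℤ)).sum

theorem streamCount_append_singleton (L : List (AnnotatedUpdate n)) (a : AnnotatedUpdate n)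
    (i : Item n) :
    streamCount (L ++ [a]) i = streamCount L i + (a.Δ : ℤ) * ((a.items.countP (· = i) : ℕ) : ℤ) := by
  simp [streamCount]

theorem count_items_annotate (Y : Fin n → ℤˣ) (a : EdgeUpdate n) (ha : a.u ≠ a.v) (i : Item n) :
    (AnnotatedUpdate.items ⟨a, Y a.u, Y a.v⟩).countP (· = i) = incidence Y s(a.u, a.v) i := by
  rcases i with ⟨v, s⟩ | e | s
  · by_cases hs : Y a.u * Y a.v = s
    · subst hs
      by_cases h1 : a.u = v
      · have h2 : a.v ≠ v := fun h => ha (h1.trans h.symm)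
        simp [AnnotatedUpdate.items, incidence, h1, h2]
      · by_cases h2 : a.v = v
        · simp [AnnotatedUpdate.items, incidence, h1, h2]
        · simp [AnnotatedUpdate.items, incidence, h1, h2, Ne.symm h1,
            Ne.symm h2]
    · simp [AnnotatedUpdate.items, incidence, hs]
  · simp [AnnotatedUpdate.items, incidence, List.countP_cons]
  · simp [AnnotatedUpdate.items, incidence, List.countP_cons]
    congr

theorem sum_countP_eq_length {α : Type*} [Fintype α] [DecidableEq α] (l : List α) :
    ∑ i, l.countP (· = i) = l.length := by
  induction l with
  | nil => simp
  | cons a l ih => simp [List.countP_cons, Finset.sum_add_distrib, ih]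

theorem sum_incidence (Y : Fin n → ℤˣ) {e : Sym2 (Fin n)} (he : ¬ e.IsDiag) :
    ∑ i, incidence Y e i = 4 := by
  induction e with | _ u v => ?_
  have huv : u ≠ v := by simpa using he
  have h := fun i => count_items_annotate Y ⟨u, v, 1⟩ huv i
  simp only at h
  simp only [← h]
  rw [sum_countP_eq_length]
  rfl

/-- A weighted sum over the stream is a weighted sum over the edges that are present. -/
theorem sum_stream_eq_sum_edgeMultiplicity (σ : List (EdgeUpdate n)) (g : Sym2 (Fin n) → ℤ) :
    (σ.map fun a => (a.Δ : ℤ) * g s(a.u, a.v)).sum = ∑ e, edgeMultiplicity σ e * g e := by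
  induction σ with
  | nil => simp [edgeMultiplicity]
  | cons a σ ih =>
    have h : ∀ e, edgeMultiplicity (a :: σ) e
        = (if s(a.u, a.v) = e then (a.Δ : ℤ) else 0) + edgeMultiplicity σ e := by
      intro e
      by_cases he : s(a.u, a.v) = e <;> simp [edgeMultiplicity, he]
    simp only [List.map_cons, List.sum_cons, ih, h, add_mul, Finset.sum_add_distrib, ite_mul,
      zero_mul, Finset.sum_ite_eq, Finset.mem_univ, if_true]

theorem streamCount_annotate {σ : List (EdgeUpdate n)} (hσ : ∀ a ∈ σ, a.u ≠ a.v)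
    (Y : Fin n → ℤˣ) (i : Item n) :
    streamCount (annotate Y σ) i = ∑ e, edgeMultiplicity σ e * (incidence Y e i : ℤ) := by
  rw [← sum_stream_eq_sum_edgeMultiplicity σ fun e => (incidence Y e i : ℤ), streamCount, annotate,
    List.map_map]
  congr 1
  refine List.map_congr_left fun a ha => ?_
  simp [← count_items_annotate Y a (hσ a ha)]

theorem edgeMultiplicity_eq_zero_of_isDiag {σ : List (EdgeUpdate n)} (hσ : ∀ a ∈ σ, a.u ≠ a.v)
    {e : Sym2 (Fin n)} (he : e.IsDiag) : edgeMultiplicity σ e = 0 := by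
  have h : σ.filter (fun a => s(a.u, a.v) = e) = [] := by
    rw [List.filter_eq_nil_iff]
    intro a ha h
    simp only [decide_eq_true_eq] at h
    subst h
    exact hσ a ha (by simpa using he)
  simp [edgeMultiplicity, h]

variable {σ : List (EdgeUpdate n)} {G : SimpleGraph (Fin n)}

theorem IsGraphStream.streamCount_eq (h : IsGraphStream σ G) (Y : Fin n → ℤˣ) (i : Item n) :
    streamCount (annotate Y σ) i = itemCount (edges G) Y i := by
  rw [streamCount_annotate h.ne, itemCount, ← Finset.sum_subset (Finset.subset_univ (edges G))]
  · refine Finset.sum_congr rfl fun e he => ?_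
    rw [(h.final e).1 (mem_edges.1 he), one_mul]
  · intro e _ he
    have h1 := h.simple σ List.prefix_rfl e
    have h2 : edgeMultiplicity σ e ≠ 1 := fun h3 => he (mem_edges.2 ((h.final e).2 h3))
    rw [h1.resolve_right h2, zero_mul]

theorem sum_itemCount (G : SimpleGraph (Fin n)) (Y : Fin n → ℤˣ) :
    ∑ i, itemCount (edges G) Y i = 4 * (edges G).card := by
  simp only [itemCount]
  rw [Finset.sum_comm, Finset.card_eq_sum_ones, Nat.cast_sum, Finset.mul_sum]
  refine Finset.sum_congr rfl fun e he => ?_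
  exact_mod_cast sum_incidence Y (not_isDiag_of_mem_edges G e he)

theorem itemCount_nonneg (E : Finset (Sym2 (Fin n))) (Y : Fin n → ℤˣ) (i : Item n) :
    0 ≤ itemCount E Y i :=
  Finset.sum_nonneg fun _ _ => Nat.cast_nonneg _

theorem IsGraphStream.streamCount_nonneg (h : IsGraphStream σ G) (Y : Fin n → ℤˣ)
    {τ : List (EdgeUpdate n)} (hτ : τ <+: σ) (i : Item n) : 0 ≤ streamCount (annotate Y τ) i := by
  rw [streamCount_annotate fun a ha => h.ne a (hτ.subset ha)]
  refine Finset.sum_nonneg fun e _ => mul_nonneg ?_ (Nat.cast_nonneg _)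
  rcases h.simple τ hτ e with h | h <;> simp [h]

theorem card_sym2_fin_le (n : ℕ) : Fintype.card (Sym2 (Fin n)) ≤ n ^ 2 := by
  rw [Sym2.card, Fintype.card_fin, Nat.choose_two_right, Nat.add_sub_cancel]
  exact Nat.div_le_of_le_mul (by nlinarith [Nat.le_self_pow two_ne_zero n])

theorem IsGraphStream.sum_streamCount_le (h : IsGraphStream σ G) (Y : Fin n → ℤˣ)
    {τ : List (EdgeUpdate n)} (hτ : τ <+: σ) :
    ∑ i, streamCount (annotate Y τ) i ≤ 4 * n ^ 2 := by
  have hne : ∀ a ∈ τ, a.u ≠ a.v := fun a ha => h.ne a (hτ.subset ha)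
  simp only [streamCount_annotate hne]
  rw [Finset.sum_comm]
  calc ∑ e, ∑ i, edgeMultiplicity τ e * (incidence Y e i : ℤ)
      ≤ ∑ e : Sym2 (Fin n), 4 := by
        refine Finset.sum_le_sum fun e _ => ?_
        rw [← Finset.mul_sum]
        by_cases he : e.IsDiag
        · simp [edgeMultiplicity_eq_zero_of_isDiag hne he]
        · have h4 : ∑ i, (incidence Y e i : ℤ) = 4 := by exact_mod_cast sum_incidence Y he
          rw [h4]
          rcases h.simple τ hτ e with h | h <;> simp [h]
    _ ≤ 4 * n ^ 2 := by
        rw [Finset.sum_const, Finset.card_univ, nsmul_eq_mul, mul_comm]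
        gcongr
        exact_mod_cast card_sym2_fin_le n

end Streams

/-! ### Deterministic algorithms and their memory -/

section Encoding

variable {n S : ℕ} {St : Type*}

namespace StreamingAlgorithm

/-- The deterministic algorithm with state transitions `step`, which stores a state as a content of
the memory that is mapped to it by `dec`. -/
noncomputable def ofStates [Nonempty (Memory n S)] (dec : Memory n S → St) (s₀ : St)
    (step : St → AnnotatedUpdate n → St) (out : St → ℝ) : StreamingAlgorithm n S where
  init := PMF.pure (Function.invFun dec s₀)
  update a m := PMF.pure (Function.invFun dec (step (dec m) a))
  output m := out (dec m)

variable [Nonempty (Memory n S)] {dec : Memory n S → St} {s₀ : St}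
  {step : St → AnnotatedUpdate n → St}

theorem run_ofStates (out : St → ℝ) (L : List (AnnotatedUpdate n))
    (h : ∀ τ, τ <+: L → τ.foldl step s₀ ∈ Set.range dec) :
    (ofStates dec s₀ step out).run L
      = PMF.pure (Function.invFun dec (L.foldl step s₀)) := by
  induction L using List.reverseRecOn with
  | nil => rfl
  | append_singleton L a ih =>
    have ih' := ih fun τ hτ => h τ (hτ.trans (List.prefix_append _ _))
    have hdec : dec (Function.invFun dec (L.foldl step s₀)) = L.foldl step s₀ :=
      Function.invFun_eq (h L (List.prefix_append _ _))
    rw [run] at ih' ⊢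
    rw [List.foldl_append, ih', List.foldl_cons, List.foldl_nil, PMF.pure_bind, List.foldl_append,
      List.foldl_cons, List.foldl_nil]
    simp only [ofStates, hdec]

theorem result_ofStates (out : St → ℝ) (L : List (AnnotatedUpdate n))
    (h : ∀ τ, τ <+: L → τ.foldl step s₀ ∈ Set.range dec) :
    (ofStates dec s₀ step out).result L = PMF.pure (out (L.foldl step s₀)) := by
  have hdec : dec (Function.invFun dec (L.foldl step s₀)) = L.foldl step s₀ :=
    Function.invFun_eq (h L List.prefix_rfl)
  rw [result, run_ofStates out L h, PMF.pure_map]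
  simp only [ofStates, hdec]

end StreamingAlgorithm

instance : Nonempty (Memory n S) := ⟨fun _ => ⟨0, by positivity⟩⟩

theorem card_memory (n S : ℕ) : Fintype.card (Memory n S) = (2 ^ wordBits n) ^ S := by
  simp [Memory]

theorem exists_memory_surjective {D : Type*} [Fintype D] [Nonempty D]
    (hD : Fintype.card D ≤ (2 ^ wordBits n) ^ S) : ∃ f : Memory n S → D, f.Surjective := by
  rw [← card_memory] at hD
  obtain ⟨g⟩ := Function.Embedding.nonempty_of_card_le hD
  exact ⟨Function.invFun g, Function.invFun_surjective g.injective⟩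

theorem lt_two_pow_wordBits (n : ℕ) : n < 2 ^ wordBits n :=
  Nat.lt_pow_succ_log_self one_lt_two n

theorem two_le_two_pow_wordBits (n : ℕ) : 2 ≤ 2 ^ wordBits n :=
  Nat.le_self_pow (by simp [wordBits]) 2

/-- An item fits into `4` words. -/
theorem card_item_le (n : ℕ) : Fintype.card (Item n) ≤ (2 ^ wordBits n) ^ 4 := by
  have h1 := lt_two_pow_wordBits n
  have h2 := two_le_two_pow_wordBits n
  have h3 := card_sym2_fin_le n
  generalize 2 ^ wordBits n = N at *
  have h4 : Fintype.card ℤˣ = 2 := rfl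
  rw [Fintype.card_sum, Fintype.card_sum, Fintype.card_prod, Fintype.card_fin, h4]
  have h5 : n ^ 2 ≤ N ^ 2 := Nat.pow_le_pow_left h1.le 2
  have h6 : 4 * N ^ 2 ≤ N ^ 4 := by
    rw [show N ^ 4 = N ^ 2 * N ^ 2 by ring]
    exact Nat.mul_le_mul_right _ (by nlinarith)
  nlinarith

/-- The bound on all counts along a stream fits into `4` words. -/
theorem streamCount_bound_lt (n : ℕ) : 4 * n ^ 2 < (2 ^ wordBits n) ^ 4 := by
  have h1 := lt_two_pow_wordBits n
  have h2 := two_le_two_pow_wordBits n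
  generalize 2 ^ wordBits n = N at *
  have h5 : n ^ 2 < N ^ 2 := Nat.pow_lt_pow_left h1 two_ne_zero
  have h6 : 4 * N ^ 2 ≤ N ^ 4 := by
    rw [show N ^ 4 = N ^ 2 * N ^ 2 by ring]
    exact Nat.mul_le_mul_right _ (by nlinarith)
  omega

/-- A deterministic algorithm whose memory determines all counts up to a small fraction of the
number of edges solves the problem: only the predictions are random. -/
theorem exists_approximatesMaxCut {r : ℕ} (hr : 0 < r) {η : ℝ}
    (hη : η * (8 * sparseBound r) = 1) (dec : Memory n S → St) (s₀ : St)
    (step : St → AnnotatedUpdate n → St) (est : St → Item n → ℝ)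
    (streams : Set (List (EdgeUpdate n)))
    (hdec : ∀ G σ Y, σ ∈ streams → IsGraphStream σ G → ∀ τ, τ <+: σ →
      (annotate Y τ).foldl step s₀ ∈ Set.range dec)
    (hest : ∀ G σ Y, σ ∈ streams → IsGraphStream σ G →
      IsEstimate η G Y (est ((annotate Y σ).foldl step s₀))) :
    ∃ A : StreamingAlgorithm n S, ∀ ε : ℝ, ε ≤ 1 / 2 → 1 / (r : ℝ) ≤ ε →
      A.ApproximatesMaxCut streams ε (1 / 2 + ε ^ 2) := by
  refine ⟨StreamingAlgorithm.ofStates dec s₀ step fun s =>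
    cutEstimate (flipBound r) (sparseBound r) (errorRate r) (est s), ?_⟩
  intro ε hε' hrε G x σ P hx hσ hG hP
  have hτ : 0 < errorRate r := by unfold errorRate; positivity
  have hε : 0 ≤ ε := le_trans (by positivity) hrε
  have hmeas := hP.two_thirds_le_measure hε hε' hx hτ
  refine hmeas.trans ?_
  rw [← lintegral_indicator_one MeasurableSet.of_discrete]
  refine lintegral_mono fun Y => ?_
  classical
  rw [Set.indicator_apply]
  split_ifs with hY
  swap
  · exact zero_le
  rw [StreamingAlgorithm.result_ofStates _ _ ?_]
  · have hmem : cutEstimate (flipBound r) (sparseBound r) (errorRate r)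
        (est ((annotate Y σ).foldl step s₀))
        ∈ Set.Icc ((1 / 2 + ε ^ 2) * (maxCut G : ℝ)) (maxCut G : ℝ) :=
      ⟨(hest G σ Y hσ hG).le_cutEstimate hr hη hx hε' hrε hY,
        (hest G σ Y hσ hG).cutEstimate_le hr hη⟩
    rw [PMF.toOuterMeasure_pure_apply, if_pos hmem]
    rfl
  · intro τ hτ
    obtain ⟨τ', hτ', rfl⟩ := List.prefix_map_iff.1 hτ
    exact hdec G σ _ hσ hG τ' hτ'

end Encoding

/-! ### Insertion-only streams: the Misra–Gries summary -/

section MisraGries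

variable {U : Type*} [Fintype U] [DecidableEq U]

/-- The Misra–Gries update with `k` counters: the counter of `i` is incremented, and if more than
`k` counters are then nonzero, all nonzero counters are decremented. -/
def misraGriesStep (k : ℕ) (c : U → ℕ) (i : U) : U → ℕ :=
  let c' : U → ℕ := fun j => c j + if j = i then 1 else 0
  if (Finset.univ.filter fun j => c' j ≠ 0).card ≤ k then c' else fun j => c' j - 1

/-- The invariant of the Misra–Gries summary `c` of the list `L`, where `d` is the number of times
that all counters were decremented. -/
theorem misraGries_invariant (k : ℕ) (L : List U) :
    ∃ d, (k + 1) * d + ∑ i, L.foldl (misraGriesStep k) (fun _ => 0) i ≤ L.length ∧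
      (∀ i, L.foldl (misraGriesStep k) (fun _ => 0) i ≤ L.countP (· = i)) ∧
      (∀ i, L.countP (· = i) ≤ L.foldl (misraGriesStep k) (fun _ => 0) i + d) ∧
      (Finset.univ.filter fun i => L.foldl (misraGriesStep k) (fun _ => 0) i ≠ 0).card ≤ k := by
  induction L using List.reverseRecOn with
  | nil => exact ⟨0, by simp⟩
  | append_singleton L i ih =>
    obtain ⟨d, hlen, hle, hge, hcard⟩ := ih
    simp only [List.foldl_append, List.foldl_cons, List.foldl_nil]
    generalize L.foldl (misraGriesStep k) (fun _ => 0) = c at *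
    have hcount : ∀ j, (L ++ [i]).countP (· = j)
        = L.countP (· = j) + if j = i then 1 else 0 := by
      intro j
      simp [List.countP_append, List.countP_cons, eq_comm]
    have hsum : ∑ j, (c j + if j = i then 1 else 0) = ∑ j, c j + 1 := by
      simp [Finset.sum_add_distrib]
    simp only [hcount, List.length_append, List.length_singleton]
    by_cases h : (Finset.univ.filter fun j => (c j + if j = i then 1 else 0) ≠ 0).card ≤ k
    · refine ⟨d, ?_, ?_, ?_, ?_⟩ <;> simp only [misraGriesStep, h, if_true]
      · rw [hsum]; omega
      · intro j; have := hle j; omega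
      · intro j; have := hge j; omega
    · have hci : c i = 0 := by
        by_contra hne
        refine h (le_trans (Finset.card_le_card fun j hj => ?_) hcard)
        simp only [Finset.mem_filter, Finset.mem_univ, true_and] at hj ⊢
        by_cases hji : j = i
        · exact hji ▸ hne
        · simpa [hji] using hj
      have hdec : ∑ j, (c j + (if j = i then 1 else 0) - 1)
          + (Finset.univ.filter fun j => (c j + if j = i then 1 else 0) ≠ 0).card
          = ∑ j, (c j + if j = i then 1 else 0) := by
        rw [Finset.card_filter, ← Finset.sum_add_distrib]
        refine Finset.sum_congr rfl fun j _ => ?_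
        generalize c j + (if j = i then 1 else 0) = a
        split_ifs <;> omega
      refine ⟨d + 1, ?_, ?_, ?_, ?_⟩ <;> simp only [misraGriesStep, h, if_false]
      · rw [hsum] at hdec
        rw [mul_add]
        omega
      · intro j; have := hle j; omega
      · intro j; have := hge j; omega
      · refine le_trans (Finset.card_le_card fun j hj => ?_) hcard
        simp only [Finset.mem_filter, Finset.mem_univ, true_and] at hj ⊢
        by_cases hji : j = i
        · subst hji; simp [hci] at hj
        · simp only [hji, if_false] at hj
          omega

open Classical in
/-- The counters that are given by a list of pairs of an item and a number. -/
noncomputable def countersOfPairs {k B : ℕ} (g : Fin k → U × Fin B) (i : U) : ℕ :=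
  if h : ∃ j, (g j).1 = i then (g h.choose).2 else 0

theorem mem_range_countersOfPairs [Nonempty U] {k B : ℕ} (c : U → ℕ) (hB : ∀ i, c i < B)
    (hk : (Finset.univ.filter fun i => c i ≠ 0).card ≤ k) :
    c ∈ Set.range (countersOfPairs : (Fin k → U × Fin B) → U → ℕ) := by
  classical
  have hcard : Fintype.card {i // c i ≠ 0} ≤ Fintype.card (Fin k) := by
    rwa [Fintype.card_subtype, Fintype.card_fin]
  obtain ⟨f⟩ := Function.Embedding.nonempty_of_card_le hcard
  obtain ⟨u⟩ := ‹Nonempty U›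
  set g : Fin k → U := fun j => if h : ∃ i, f i = j then h.choose.1 else u with hg
  have hgf : ∀ i, g (f i) = i.1 := by
    intro i
    have h : ∃ i', f i' = f i := ⟨i, rfl⟩
    simp only [hg, h, dif_pos]
    exact congrArg Subtype.val (f.injective h.choose_spec)
  refine ⟨fun j => (g j, ⟨c (g j), hB _⟩), ?_⟩
  funext i
  unfold countersOfPairs
  split_ifs with h
  · exact congrArg c h.choose_spec
  · by_contra hne
    exact h ⟨f ⟨i, fun h0 => hne h0.symm⟩, hgf _⟩

end MisraGries

section InsertionOnly

variable {n : ℕ}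

theorem streamCount_eq_countP_flatMap {L : List (AnnotatedUpdate n)} (hL : ∀ a ∈ L, a.Δ = 1)
    (i : Item n) :
    streamCount L i = (L.flatMap AnnotatedUpdate.items).countP (· = i) := by
  rw [List.countP_flatMap, streamCount, Nat.cast_list_sum, List.map_map]
  congr 1
  refine List.map_congr_left fun a ha => ?_
  simp [hL a ha]

/-- The update of the Misra–Gries summary of all items by one stream element. -/
def insertionStep (k : ℕ) (c : Item n → ℕ) (a : AnnotatedUpdate n) : Item n → ℕ :=
  a.items.foldl (misraGriesStep k) c

/-- A counter takes `8` words: `4` for its item and `4` for its value. -/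
theorem exists_insertionOnly_algorithm (n : ℕ) {r : ℕ} (hr : 0 < r) :
    ∃ A : StreamingAlgorithm n (8 * (4 * (8 * sparseBound r))),
      ∀ ε : ℝ, ε ≤ 1 / 2 → 1 / (r : ℝ) ≤ ε →
        A.ApproximatesMaxCut {σ | IsInsertionOnly σ} ε (1 / 2 + ε ^ 2) := by
  have hM := sparseBound_pos hr
  have hM' : (0 : ℝ) < sparseBound r := by exact_mod_cast hM
  set k := 4 * (8 * sparseBound r) with hk
  set B := (2 ^ wordBits n) ^ 4 with hB
  have hBpos : 0 < B := by positivity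
  have : Nonempty (Fin B) := ⟨⟨0, hBpos⟩⟩
  have : Nonempty (Item n) := ⟨.inr (.inr 1)⟩
  have hcard : Fintype.card (Fin k → Item n × Fin B) ≤ (2 ^ wordBits n) ^ (8 * k) := by
    rw [Fintype.card_fun, Fintype.card_fin, Fintype.card_prod, Fintype.card_fin,
      pow_mul _ 8 k]
    refine Nat.pow_le_pow_left ?_ k
    calc Fintype.card (Item n) * B ≤ B * B := Nat.mul_le_mul_right _ (card_item_le n)
      _ = (2 ^ wordBits n) ^ 8 := by rw [hB]; ring
  obtain ⟨dec, hdec⟩ := exists_memory_surjective hcard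
  have hins : ∀ {σ : List (EdgeUpdate n)} (Y), IsInsertionOnly σ → ∀ τ, τ <+: σ →
      ∀ a ∈ annotate Y τ, a.Δ = 1 := by
    intro σ Y hσ τ hτ a ha
    obtain ⟨b, hb, rfl⟩ := List.mem_map.1 ha
    exact hσ b (hτ.subset hb)
  refine exists_approximatesMaxCut hr (η := 1 / (8 * sparseBound r)) (by field_simp)
    (fun m => countersOfPairs (dec m)) (fun _ => 0) (insertionStep k) (fun c i => (c i : ℝ)) _ ?_ ?_
  · intro G σ Y hσ hG τ hτ
    obtain ⟨d, -, hle, -, hsupp⟩ :=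
      misraGries_invariant k ((annotate Y τ).flatMap AnnotatedUpdate.items)
    rw [List.foldl_flatMap] at hle hsupp
    have hlt : ∀ i, (annotate Y τ).foldl (insertionStep k) (fun _ => 0) i < B := by
      intro i
      refine lt_of_le_of_lt (hle i) (lt_of_le_of_lt ?_ (streamCount_bound_lt n))
      have h1 := Finset.single_le_sum (f := streamCount (annotate Y τ))
        (fun j _ => hG.streamCount_nonneg Y hτ j) (Finset.mem_univ i)
      have h2 := h1.trans (hG.sum_streamCount_le Y hτ)
      rw [streamCount_eq_countP_flatMap (hins Y hσ τ hτ)] at h2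
      exact_mod_cast h2
    obtain ⟨g, hg⟩ := mem_range_countersOfPairs _ hlt hsupp
    obtain ⟨m, rfl⟩ := hdec g
    exact ⟨m, hg⟩
  · intro G σ Y hσ hG i
    obtain ⟨d, hlen, hle, hge, -⟩ :=
      misraGries_invariant k ((annotate Y σ).flatMap AnnotatedUpdate.items)
    have hcount : ∀ j, (((annotate Y σ).flatMap AnnotatedUpdate.items).countP (· = j) : ℤ)
        = itemCount (edges G) Y j := by
      intro j
      rw [← streamCount_eq_countP_flatMap (hins Y hσ σ List.prefix_rfl), hG.streamCount_eq]
    have hlength : ((annotate Y σ).flatMap AnnotatedUpdate.items).length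
        = 4 * (edges G).card := by
      have h := sum_itemCount G Y
      simp only [← hcount] at h
      rw [← sum_countP_eq_length]
      exact_mod_cast h
    rw [hlength] at hlen
    have h1 := hle i
    have h2 := hge i
    rw [List.foldl_flatMap] at h1 h2
    change (annotate Y σ).foldl (insertionStep k) (fun _ => 0) i ≤ _ at h1
    change _ ≤ (annotate Y σ).foldl (insertionStep k) (fun _ => 0) i + d at h2
    rw [← hcount i, Int.cast_natCast]
    have hd : (d : ℝ) ≤ 1 / (8 * sparseBound r) * (edges G).card := by
      have h3 : (k + 1) * d ≤ 4 * (edges G).card := le_trans (Nat.le_add_right _ _) hlen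
      have h4 : (8 * sparseBound r) * d ≤ (edges G).card := by
        rw [hk] at h3
        nlinarith
      have h5 : (8 * sparseBound r : ℝ) * d ≤ (edges G).card := by exact_mod_cast h4
      rw [one_div, ← div_eq_inv_mul, le_div_iff₀ (by positivity)]
      linarith
    have h1' : (((annotate Y σ).foldl (insertionStep k) (fun _ => 0) i : ℕ) : ℝ)
        ≤ (((annotate Y σ).flatMap AnnotatedUpdate.items).countP (· = i) : ℕ) := by
      exact_mod_cast h1
    have h2' : ((((annotate Y σ).flatMap AnnotatedUpdate.items).countP (· = i) : ℕ) : ℝ)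
        ≤ ((annotate Y σ).foldl (insertionStep k) (fun _ => 0) i : ℕ) + d := by
      exact_mod_cast h2
    rw [abs_le]
    constructor <;> linarith

end InsertionOnly

/-! ### Fully dynamic streams: hashing with Reed–Solomon codes -/

section Hashing

variable {n : ℕ} {A B : Type*} [DecidableEq B]

/-- The update of the counters of the hash functions `h · a` by one stream element: the counter
`(a, b)` holds the sum of the counts of all items that `h · a` maps to `b`. -/
def hashStep (h : Item n → A → B) (C : A × B → ℤ) (a : AnnotatedUpdate n) : A × B → ℤ :=
  fun p => C p + ∑ i with h i p.1 = p.2, (a.Δ : ℤ) * ((a.items.countP (· = i) : ℕ) : ℤ)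

/-- The average over all hash functions of the counter to which the item `i` belongs. -/
noncomputable def hashEstimate [Fintype A] (h : Item n → A → B) (C : A × B → ℤ) (i : Item n) : ℝ :=
  (∑ a, (C (a, h i a) : ℝ)) / Fintype.card A

theorem foldl_hashStep (h : Item n → A → B) (L : List (AnnotatedUpdate n)) (p : A × B) :
    L.foldl (hashStep h) (fun _ => 0) p = ∑ i with h i p.1 = p.2, streamCount L i := by
  induction L using List.reverseRecOn with
  | nil => simp [streamCount]
  | append_singleton L a ih =>
    simp only [List.foldl_append, List.foldl_cons, List.foldl_nil, streamCount_append_singleton,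
      Finset.sum_add_distrib]
    rw [hashStep, ih]

/-- If any two items collide for at most `κ` of the hash functions, then the average error of the
counters of an item is small. -/
theorem abs_hashEstimate_sub_le [Fintype A] [Nonempty A] (h : Item n → A → B) {κ : ℕ}
    (hκ : ∀ i j, i ≠ j → (Finset.univ.filter fun a => h i a = h j a).card ≤ κ) {f : Item n → ℤ}
    (hf : ∀ i, 0 ≤ f i) {C : A × B → ℤ} (hC : ∀ p, C p = ∑ i with h i p.1 = p.2, f i)
    (i : Item n) :
    |hashEstimate h C i - f i| ≤ κ * (∑ j, f j : ℤ) / Fintype.card A := by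
  have hA : (0 : ℝ) < Fintype.card A := by exact_mod_cast Fintype.card_pos
  have hsum : ∑ a, C (a, h i a)
      = ∑ j, f j * (Finset.univ.filter fun a => h j a = h i a).card := by
    simp only [hC, Finset.sum_filter]
    rw [Finset.sum_comm]
    refine Finset.sum_congr rfl fun j _ => ?_
    rw [← Finset.sum_filter, Finset.sum_const, nsmul_eq_mul, mul_comm]
  have hdiff : |∑ a, C (a, h i a) - f i * Fintype.card A| ≤ κ * ∑ j, f j := by
    rw [hsum, ← Finset.add_sum_erase _ _ (Finset.mem_univ i)]
    simp only [Finset.filter_true, Finset.card_univ, add_sub_cancel_left]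
    refine (Finset.abs_sum_le_sum_abs _ _).trans ?_
    rw [Finset.mul_sum]
    refine (Finset.sum_le_sum fun j hj => ?_).trans (Finset.sum_le_sum_of_subset_of_nonneg
      (Finset.erase_subset i _) fun j _ _ => mul_nonneg (Nat.cast_nonneg _) (hf j))
    rw [abs_mul, abs_of_nonneg (hf j), Nat.abs_cast, mul_comm]
    exact mul_le_mul_of_nonneg_right (by exact_mod_cast hκ j i (Finset.ne_of_mem_erase hj)) (hf j)
  have hdiff' : |∑ a, (C (a, h i a) : ℝ) - f i * Fintype.card A| ≤ κ * (∑ j, f j : ℤ) := by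
    exact_mod_cast hdiff
  have heq : hashEstimate h C i - f i
      = (∑ a, (C (a, h i a) : ℝ) - f i * Fintype.card A) / Fintype.card A := by
    rw [hashEstimate]
    field_simp
  rw [heq, abs_div, abs_of_pos hA]
  gcongr

open Polynomial in
/-- Polynomials of degree less than `κ` over a field, as hash functions: two of them agree at less
than `κ` points. -/
theorem exists_hash {U : Type*} [Fintype U] {q : ℕ} [Fact q.Prime] {κ : ℕ}
    (hU : Fintype.card U ≤ q ^ κ) :
    ∃ h : U → ZMod q → ZMod q, ∀ i j, i ≠ j →
      (Finset.univ.filter fun a => h i a = h j a).card ≤ κ := by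
  have hcard : Fintype.card U ≤ Fintype.card (Fin κ → ZMod q) := by
    simpa [ZMod.card] using hU
  obtain ⟨g⟩ := Function.Embedding.nonempty_of_card_le hcard
  refine ⟨fun i a => ((degreeLTEquiv (ZMod q) κ).symm (g i) : (ZMod q)[X]).eval a,
    fun i j hij => ?_⟩
  set P := (degreeLTEquiv (ZMod q) κ).symm (g i) with hP
  set Q := (degreeLTEquiv (ZMod q) κ).symm (g j) with hQ
  have hne : (P : (ZMod q)[X]) - Q ≠ 0 := by
    rw [sub_ne_zero]
    intro h
    exact hij (g.injective ((degreeLTEquiv (ZMod q) κ).symm.injective (Subtype.ext h)))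
  have hmem : (P : (ZMod q)[X]) - Q ∈ degreeLT (ZMod q) κ := Submodule.sub_mem _ P.2 Q.2
  have hdeg : ((P : (ZMod q)[X]) - Q).natDegree ≤ κ :=
    ((natDegree_lt_iff_degree_lt hne).2 (mem_degreeLT.1 hmem)).le
  calc _ ≤ ((P : (ZMod q)[X]) - Q).roots.toFinset.card := by
        refine Finset.card_le_card fun a ha => ?_
        simp only [Finset.mem_filter, Finset.mem_univ, true_and] at ha
        rw [Multiset.mem_toFinset, mem_roots hne, IsRoot, eval_sub, ha, sub_self]
    _ ≤ Multiset.card ((P : (ZMod q)[X]) - Q).roots := Multiset.toFinset_card_le _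
    _ ≤ κ := (card_roots' _).trans hdeg

/-- The sketch has `q ^ 2` counters of `4` words each. Items are encoded by polynomials of degree less
than `4 * wordBits n`, and `q` is large enough for the collisions to be a fraction
`1 / (32 * sparseBound r)` of the hash functions. -/
theorem exists_dynamic_algorithm (n : ℕ) {r : ℕ} (hr : 0 < r) {q : ℕ} (hq : q.Prime)
    (hqr : 16 * wordBits n * (8 * sparseBound r) ≤ q) :
    ∃ A : StreamingAlgorithm n (4 * q ^ 2),
      ∀ ε : ℝ, ε ≤ 1 / 2 → 1 / (r : ℝ) ≤ ε →
        A.ApproximatesMaxCut Set.univ ε (1 / 2 + ε ^ 2) := by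
  have : Fact q.Prime := ⟨hq⟩
  have hM' : (0 : ℝ) < sparseBound r := by exact_mod_cast sparseBound_pos hr
  have hU : Fintype.card (Item n) ≤ q ^ (4 * wordBits n) :=
    calc Fintype.card (Item n) ≤ (2 ^ wordBits n) ^ 4 := card_item_le n
      _ = 2 ^ (4 * wordBits n) := by rw [← pow_mul, mul_comm]
      _ ≤ q ^ (4 * wordBits n) := Nat.pow_le_pow_left hq.two_le _
  obtain ⟨h, hκ⟩ := exists_hash hU
  set B := (2 ^ wordBits n) ^ 4 with hB
  have : Nonempty (Fin B) := ⟨⟨0, by positivity⟩⟩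
  have hcard : Fintype.card (ZMod q × ZMod q → Fin B) ≤ (2 ^ wordBits n) ^ (4 * q ^ 2) := by
    rw [Fintype.card_fun, Fintype.card_fin, Fintype.card_prod, ZMod.card, hB, ← pow_mul _ 4, sq]
  obtain ⟨dec, hdec⟩ := exists_memory_surjective hcard
  refine exists_approximatesMaxCut hr (η := 1 / (8 * sparseBound r)) (by field_simp)
    (fun m p => ((dec m p : ℕ) : ℤ)) (fun _ => 0) (hashStep h) (hashEstimate h) _ ?_ ?_
  · intro G σ Y _ hG τ hτ
    have hnn : ∀ p, 0 ≤ (annotate Y τ).foldl (hashStep h) (fun _ => 0) p := by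
      intro p
      rw [foldl_hashStep]
      exact Finset.sum_nonneg fun i _ => hG.streamCount_nonneg Y hτ i
    have hlt : ∀ p, ((annotate Y τ).foldl (hashStep h) (fun _ => 0) p).toNat < B := by
      intro p
      have h1 : (annotate Y τ).foldl (hashStep h) (fun _ => 0) p ≤ 4 * n ^ 2 := by
        rw [foldl_hashStep]
        exact (Finset.sum_le_sum_of_subset_of_nonneg (Finset.subset_univ _)
          fun i _ _ => hG.streamCount_nonneg Y hτ i).trans (hG.sum_streamCount_le Y hτ)
      have h2 := streamCount_bound_lt n
      rw [← hB] at h2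
      refine lt_of_le_of_lt (Int.toNat_le.2 ?_) h2
      exact_mod_cast h1
    obtain ⟨m, hm⟩ := hdec fun p => ⟨_, hlt p⟩
    refine ⟨m, ?_⟩
    funext p
    simp only [hm]
    exact Int.toNat_of_nonneg (hnn p)
  · intro G σ Y _ hG i
    have hC : ∀ p, (annotate Y σ).foldl (hashStep h) (fun _ => 0) p
        = ∑ i with h i p.1 = p.2, itemCount (edges G) Y i := by
      intro p
      rw [foldl_hashStep]
      exact Finset.sum_congr rfl fun i _ => hG.streamCount_eq Y i
    refine (abs_hashEstimate_sub_le h hκ (itemCount_nonneg (edges G) Y) hC i).trans ?_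
    rw [sum_itemCount, ZMod.card]
    have hqr' : (16 * wordBits n * (8 * sparseBound r) : ℝ) ≤ q := by exact_mod_cast hqr
    have hq0 : (0 : ℝ) < q := by exact_mod_cast hq.pos
    rw [one_div, ← div_eq_inv_mul, div_le_div_iff₀ hq0 (by positivity)]
    push_cast
    have := mul_le_mul_of_nonneg_right hqr' (Nat.cast_nonneg (α := ℝ) (edges G).card)
    linarith

end Hashing

/-! ### Space bounds -/

theorem wordBits_le (n : ℕ) : (wordBits n : ℝ) ≤ 2 * (1 + Real.log n) := by
  rw [wordBits]
  rcases Nat.eq_zero_or_pos n with rfl | hn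
  · simp
  have h1 : (2 : ℝ) ^ Nat.log 2 n ≤ n := by exact_mod_cast Nat.pow_log_le_self 2 hn.ne'
  have h2 := Real.log_le_log (by positivity) h1
  rw [Real.log_pow] at h2
  have h3 : (1 : ℝ) / 2 ≤ Real.log 2 := by linarith [Real.log_two_gt_d9]
  have h4 : (0 : ℝ) ≤ Nat.log 2 n := Nat.cast_nonneg _
  push_cast
  nlinarith

theorem eight_mul_sparseBound (r : ℕ) : 8 * sparseBound r = 1146617856 * r ^ 10 := by
  rw [sparseBound, flipBound]
  ring

theorem theorem1 :
    ∀ K : ℝ, 1 ≤ K → ∃ c : ℝ, 0 < c ∧ ∃ (C : ℝ) (d : ℕ), ∀ (n : ℕ) (ε₀ : ℝ),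
      (∃ (S : ℕ) (A : StreamingAlgorithm n S), ∀ ε : ℝ, 0 < ε → ε ≤ 1 / 2 →
        ε₀ ≤ ε → ε ≤ K * ε₀ →
          (S : ℝ) ≤ C * (1 / ε) ^ d ∧
          A.ApproximatesMaxCut {σ | IsInsertionOnly σ} ε (1 / 2 + c * ε ^ 2)) ∧
      (∃ (S : ℕ) (A : StreamingAlgorithm n S), ∀ ε : ℝ, 0 < ε → ε ≤ 1 / 2 →
        ε₀ ≤ ε → ε ≤ K * ε₀ →
          (S : ℝ) ≤ C * (1 / ε) ^ d * (1 + Real.log n) ^ d ∧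
          A.ApproximatesMaxCut Set.univ ε (1 / 2 + c * ε ^ 2)) := by
  intro K hK
  refine ⟨1, one_pos, 16384 * 1146617856 ^ 2 * (2 * K) ^ 20, 20, fun n ε₀ => ?_⟩
  -- An accuracy parameter with `1 / r ≤ ε₀` that is still `O(K / ε)`.
  set r := ⌈1 / ε₀⌉₊ + 1 with hr
  have hr0 : 0 < r := Nat.succ_pos _
  have hr1 : (1 : ℝ) ≤ r := by exact_mod_cast hr0
  have hrε : ∀ ε : ℝ, 0 < ε → ε₀ ≤ ε → ε ≤ K * ε₀ → 1 / (r : ℝ) ≤ ε := by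
    intro ε hε h1 h2
    have hε₀ : 0 < ε₀ := by by_contra hneg; nlinarith
    refine le_trans ?_ h1
    rw [one_div_le (by positivity) hε₀, hr]
    push_cast
    linarith [Nat.le_ceil (1 / ε₀)]
  have hrle : ∀ ε : ℝ, 0 < ε → ε ≤ 1 / 2 → ε₀ ≤ ε → ε ≤ K * ε₀ →
      (r : ℝ) ^ 20 ≤ (2 * K) ^ 20 * (1 / ε) ^ 20 := by
    intro ε hε hε' h1 h2
    have hε₀ : 0 < ε₀ := by by_contra hneg; nlinarith
    rw [← mul_pow]
    refine pow_le_pow_left₀ (by positivity) ?_ 20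
    have h3 : (r : ℝ) ≤ 1 / ε₀ + 2 := by
      rw [hr]
      push_cast
      linarith [Nat.ceil_lt_add_one (show 0 ≤ 1 / ε₀ by positivity)]
    have h4 : 1 / ε₀ ≤ K * (1 / ε) := by
      rw [mul_one_div, div_le_div_iff₀ hε₀ hε]
      linarith
    have h5 : 2 ≤ 1 / ε₀ := by
      rw [le_div_iff₀ hε₀]
      linarith
    linarith
  constructor
  · obtain ⟨A, hA⟩ := exists_insertionOnly_algorithm n hr0
    refine ⟨_, A, fun ε hε hε' h1 h2 => ⟨?_, ?_⟩⟩
    swap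
    · rw [one_mul]
      exact hA ε hε' (hrε ε hε h1 h2)
    have h3 := hrle ε hε hε' h1 h2
    have h4 : (r : ℝ) ^ 10 ≤ (r : ℝ) ^ 20 := pow_le_pow_right₀ hr1 (by norm_num)
    rw [eight_mul_sparseBound]
    push_cast
    rw [mul_assoc]
    linarith [pow_nonneg (zero_le_one.trans hr1) 10]
  · have hM := sparseBound_pos hr0
    obtain ⟨q, hq, hq1, hq2⟩ := Nat.exists_prime_lt_and_le_two_mul
      (16 * wordBits n * (8 * sparseBound r)) (by simp [wordBits, hM.ne'])
    obtain ⟨A, hA⟩ := exists_dynamic_algorithm n hr0 hq hq1.le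
    refine ⟨_, A, fun ε hε hε' h1 h2 => ⟨?_, ?_⟩⟩
    swap
    · rw [one_mul]
      exact hA ε hε' (hrε ε hε h1 h2)
    have h3 := hrle ε hε hε' h1 h2
    have hlog : 0 ≤ Real.log n := Real.log_natCast_nonneg n
    have hq3 : (q : ℝ) ≤ 64 * (1 + Real.log n) * (1146617856 * (r : ℝ) ^ 10) := by
      have h5 : (q : ℝ) ≤ 2 * (16 * wordBits n * (1146617856 * (r : ℝ) ^ 10)) := by
        rw [eight_mul_sparseBound] at hq2
        exact_mod_cast hq2
      have h6 := mul_le_mul_of_nonneg_right (wordBits_le n)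
        (show 0 ≤ 1146617856 * (r : ℝ) ^ 10 by positivity)
      linarith
    have h7 : (1 + Real.log n) ^ 2 ≤ (1 + Real.log n) ^ 20 :=
      pow_le_pow_right₀ (by linarith) (by norm_num)
    push_cast
    calc 4 * (q : ℝ) ^ 2
        ≤ 4 * (64 * (1 + Real.log n) * (1146617856 * (r : ℝ) ^ 10)) ^ 2 := by gcongr
      _ = 16384 * 1146617856 ^ 2 * (r : ℝ) ^ 20 * (1 + Real.log n) ^ 2 := by ring
      _ ≤ 16384 * 1146617856 ^ 2 * ((2 * K) ^ 20 * (1 / ε) ^ 20) * (1 + Real.log n) ^ 20 := by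
          gcongr
      _ = _ := by ring
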